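/- Consider a stochastic bandit problem with a finite nonempty set of arms $\mathcal{A}$; each arm $a$ is associated with a finitely supported probability distribution $\nu_a$ on $[0,1]$ with expectation $\mu_a$. Let $\mu^\star = \max_a \mu_a$ and $\Delta_a = \mu^\star - \mu_a$, and assume $\mu^\star \in (0,1)$. In each round $t \ge 1$ the player picks an arm $A_t$, on the basis of the past arms and payoffs and possibly of auxiliary randomization, and then receives a payoff $Y_t \in [0,1]$ which, conditionally on the information available when $A_t$ has been chosen, is distributed according to $\nu_{A_t}$. Let $N_T(a) = \sum_{t=1}^T \mathbb{I}_{\{A_t = a\}}$ and let $R_T = \mathbb{E}\bigl[T\mu^\star - \sum_{t=1}^T Y_t\bigr]$ be the expected regret. Let $\mathcal{P}_F([0,1])$ be the set of finitely supported probability distributions on $[0,1]$, let $E(\nu)$ denote the expectation of $\nu$ and $\mathcal{K}(\nu,\nu')$ the Kullback--Leibler divergence, and put $$\mathcal{K}_{\inf}(\nu,\mu) = \inf\bigl\{\mathcal{K}(\nu,\nu') : \nu' \in \mathcal{P}_F([0,1]),\ E(\nu') > \mu\bigr\}, \qquad \inf\emptyset = +\infty .$$ The $\mathcal{K}_{\inf}$-strategy,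 run with $f(t) = \log t$, pulls each arm once in the first $|\mathcal{A}|$ rounds. For $t \ge |\mathcal{A}|$, let $\hat\nu_{a,t}$ be the empirical distribution of the payoffs obtained from the arm $a$ in the rounds $1,\dots,t$, and $$B^+_{a,t} = \sup\bigl\{ q \in [0,1] : N_t(a)\,\mathcal{K}_{\inf}(\hat\nu_{a,t},q) \le f(t)\bigr\};$$ in round $t+1$ the strategy pulls an arm with largest index $B^+_{a,t}$ and, among the arms with largest index, one with largest empirical mean $E(\hat\nu_{a,t})$ (remaining ties being broken in any way). Then $0 < \mathcal{K}_{\inf}(\nu_a,\mu^\star) < \infty$ for every arm $a$ with $\Delta_a > 0$, and there is a function $h : \mathbb{R} \to \mathbb{R}$, depending only on the distributions $(\nu_a)_{a \in \mathcal{A}}$, such that every run of the $\mathcal{K}_{\inf}$-strategy has the following properties. 1. For all $c > 0$ and all $T \ge 1$, $$R_T \le \sum_{a : \Delta_a > 0} \Delta_a \frac{(1+c)\log T}{\mathcal{K}_{\inf}(\nu_a,\mu^\star)} + h(c).$$ 2. Consequently, $$\limsup_{T\to\infty} \frac{R_T}{\log T} \le \sum_{a : \Delta_a > 0} \frac{\Delta_a}{\mathcal{K}_{\inf}(\nu_a,\mu^\star)}.$$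 3. The strategy attains the asymptotically optimal Burnetas--Katehakis rate: for every arm $a$ with $\Delta_a > 0$, $$\limsup_{T\to\infty} \frac{\mathbb{E}[N_T(a)]}{\log T} \le \frac{1}{\mathcal{K}_{\inf}(\nu_a,\mu^\star)}.$$ -/

import Mathlib

open MeasureTheory Filter
open scoped ENNReal

noncomputable section

namespace KinfBandit

/-- The set of probability distributions on `[0,1]` with finite support, seen as Borel measures
on the real line. -/
def finSuppDist : Set (Measure ℝ) :=
  {ν | IsProbabilityMeasure ν ∧ ∃ S : Finset ℝ, (S : Set ℝ) ⊆ Set.Icc 0 1 ∧ ν (S : Set ℝ)ᶜ = 0}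

/-- The expectation `E(ν)` of a distribution on the real line. -/
def mean (ν : Measure ℝ) : ℝ := ∫ x, x ∂ν

/-- `K_inf(ν, μ)`: the infimum of the Kullback-Leibler divergences `K(ν, ν')` over the finitely
supported distributions `ν'` on `[0,1]` with `E(ν') > μ` (an infimum over the empty set is `∞`). -/
def Kinf (ν : Measure ℝ) (μ : ℝ) : ℝ≥0∞ :=
  ⨅ ν' ∈ {ν' | ν' ∈ finSuppDist ∧ μ < mean ν'}, InformationTheory.klDiv ν ν'

section Bandit

variable {𝒜 : Type*} [Fintype 𝒜] [DecidableEq 𝒜]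

/-- The largest expectation of an arm. -/
def bestMean (ν : 𝒜 → Measure ℝ) : ℝ := ⨆ a, mean (ν a)

/-- The gap of the arm `a`. -/
def gap (ν : 𝒜 → Measure ℝ) (a : 𝒜) : ℝ := bestMean ν - mean (ν a)

variable {Ω : Type*}

/-- The rounds among `1, …, t` in which the arm `a` is pulled. -/
def pullRounds (A : ℕ → Ω → 𝒜) (a : 𝒜) (t : ℕ) (ω : Ω) : Finset ℕ :=
  (Finset.Icc 1 t).filter fun s => A s ω = a

/-- `N_t(a)`, the number of times the arm `a` is pulled in the rounds `1, …, t`. -/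
def numPulls (A : ℕ → Ω → 𝒜) (a : 𝒜) (t : ℕ) (ω : Ω) : ℕ :=
  (pullRounds A a t ω).card

/-- The empirical distribution of the payoffs of the arm `a` in the rounds `1, …, t`
(used only when `N_t(a) > 0`). -/
def empDist (A : ℕ → Ω → 𝒜) (Y : ℕ → Ω → ℝ) (a : 𝒜) (t : ℕ) (ω : Ω) : Measure ℝ :=
  (numPulls A a t ω : ℝ≥0∞)⁻¹ • ∑ s ∈ pullRounds A a t ω, Measure.dirac (Y s ω)

/-- The index `B⁺_{a,t}`: the largest `q ∈ [0,1]` with `N_t(a) K_inf(ν̂, q) ≤ f(t)`, where `ν̂` is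
the empirical distribution. It is written as a supremum, since the maximum is not attained
when `ν̂` is the Dirac mass at `1` (the set is then `[0,1)`, and the index is `1`). -/
def index (f : ℕ → ℝ) (A : ℕ → Ω → 𝒜) (Y : ℕ → Ω → ℝ) (a : 𝒜) (t : ℕ) (ω : Ω) : ℝ :=
  sSup {q : ℝ | q ∈ Set.Icc 0 1 ∧
    (((numPulls A a t ω : ℝ≥0∞) * Kinf (empDist A Y a t ω) q : ℝ≥0∞) : EReal) ≤ (f t : EReal)}

/-- A run of the bandit game with arms `ν`, where `A t` and `Y t` are the arm pulled and the payoff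
received in round `t ≥ 1` (the values at `t = 0` play no role). The σ-algebra `ℱ t` holds the
information available to the player when choosing the arm of round `t + 1`, auxiliary
randomization included: the arm `A (t+1)` is a function of this information, and, given
this information, the payoff `Y (t+1)` is distributed according to `ν (A (t+1))`. -/
structure IsBanditRun [MeasurableSpace Ω] (ν : 𝒜 → Measure ℝ) (P : Measure Ω)
    (ℱ : Filtration ℕ (inferInstance : MeasurableSpace Ω))
    (A : ℕ → Ω → 𝒜) (Y : ℕ → Ω → ℝ) : Prop where
  measurable_arm : ∀ (t : ℕ) (a : 𝒜), MeasurableSet[ℱ t] {ω | A (t + 1) ω = a}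
  measurable_payoff : ∀ t : ℕ, Measurable[ℱ (t + 1)] (Y (t + 1))
  condLaw_payoff : ∀ (t : ℕ) (B : Set ℝ), MeasurableSet B →
    P[(Y (t + 1) ⁻¹' B).indicator (fun _ => (1 : ℝ)) | ℱ t]
      =ᵐ[P] fun ω => (ν (A (t + 1) ω)).real B

/-- The arms are chosen by the `K_inf`-strategy with parameter `f`: each arm is pulled once in the
first `|𝒜|` rounds, and for `t ≥ |𝒜|` the arm pulled in round `t + 1` has the largest index and, among
the arms with the largest index, the largest empirical average (remaining ties being
broken in any way). -/
def IsKinfStrategy [MeasurableSpace Ω] (f : ℕ → ℝ) (P : Measure Ω)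
    (A : ℕ → Ω → 𝒜) (Y : ℕ → Ω → ℝ) : Prop :=
  ∀ᵐ ω ∂P, (∀ a, numPulls A a (Fintype.card 𝒜) ω = 1) ∧
    ∀ t, Fintype.card 𝒜 ≤ t → ∀ b,
      index f A Y b t ω ≤ index f A Y (A (t + 1) ω) t ω ∧
      (index f A Y b t ω = index f A Y (A (t + 1) ω) t ω →
        mean (empDist A Y b t ω) ≤ mean (empDist A Y (A (t + 1) ω) t ω))

/-- The expected regret `R_T`. -/
def regret [MeasurableSpace Ω] (ν : 𝒜 → Measure ℝ) (P : Measure Ω) (Y : ℕ → Ω → ℝ) (T : ℕ) : ℝ :=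
  ∫ ω, (T * bestMean ν - ∑ t ∈ Finset.Icc 1 T, Y t ω) ∂P

end Bandit

end KinfBandit

end

/-!
The regret is the sum of the expected numbers of pulls `N_T(a)` weighted by the gaps
(`IsBanditRun.regret_eq`), so that everything follows from a finite-time bound on `E[N_T(a)]` for a
suboptimal arm `a` (`exists_integral_numPulls_le`). The proof of this bound uses neither a dual
formula for `Kinf` nor a compactness argument.

*Probability of a type.* The payoffs of an arm after `n` pulls are described by their type, the
vector `k` of the numbers of occurrences of the points of the support `S`. Let `K(k)` be the
relative entropy of `k / n` with respect to the distribution of the arm. The product of the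
likelihood ratios of `k / n` over the first `n` payoffs of the arm is a nonnegative martingale of
mean one, and it is equal to `exp (n K(k))` if the type `k` occurs
(`IsBanditRun.exists_type_majorant`). Thus every type occurs with probability at most
`exp (-n K(k))`, in spite of the adaptive choice of the arms. If the types in question satisfy
`K(k) ≥ δ`, these bounds have a finite sum over all types, because `∑ exp (-δ n)` over all vectors
`k` factorizes into geometric series (`sum_exp_neg_types_le`).

*Rounds with a low index of an optimal arm `b`.* Suppose that the index of `b` is below `μ⋆ - ε` in
round `t`, when the empirical distribution `p` comes from a type `k` of size `n`. Then
`log t < n Kinf(p, μ⋆ - ε)`. The mixture `(1 - s) ν_b + s p` with a small `s` still has a mean above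
`μ⋆ - ε`, and convexity gives `Kinf(p, μ⋆ - ε) ≤ (1 - s) K(k)`
(`exists_Kinf_le_mul_relEntropy`). At most `exp (n (1 - s) K(k))` rounds `t` are possible for the
type `k`, hence their expected number is at most `exp (-n s K(k))`. As the mean of `p` is at most
`μ⋆ - ε`, `K(k)` is bounded below, and the sum over the types is finite
(`IsBanditRun.exists_card_index_lt_le`). Counting the rounds in this way, instead of adding up
probabilities over `t`, is what makes the choice `f(t) = log t` possible.

*Pulls of `a` with a high index.* In the other rounds in which `a` is pulled, its index is at least
`μ⋆ - ε`, so that `n Kinf(p, q) ≤ log T` for any level `q < μ⋆ - ε`. Once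
`n > (1 + c) log T / Kinf(ν_a, μ⋆)`, this makes `Kinf(p, q)` smaller than
`Kinf(ν_a, μ⋆) / (1 + c)`. By lower semicontinuity of `Kinf` (`exists_eventually_le_Kinf`) the
distribution `p` is then far from `ν_a`, and each such type accounts for at most one pull of `a`
(`IsBanditRun.exists_card_lt_index_le`).
-/

noncomputable section

namespace KinfBandit

/-! ### Relative entropy of weight vectors -/

section RelEntropy

variable {ι : Type*} [Fintype ι]

/-- The relative entropy `∑ p log (p / q)` of two weight vectors. It is the Kullback-Leibler
divergence only when `q i = 0` implies `p i = 0`; otherwise the infinite terms are read as `0`. -/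
def relEntropy (p q : ι → ℝ) : ℝ := ∑ i, p i * Real.log (p i / q i)

/-- The relative entropy dominates the squared Hellinger distance, hence the squared distance
of the individual weights. The vector `q` may have total mass less than one. -/
lemma sq_sub_div_four_le_relEntropy {p q : ι → ℝ} (hp : ∀ i, 0 ≤ p i) (hq : ∀ i, 0 ≤ q i)
    (hac : ∀ i, q i = 0 → p i = 0) (hp1 : ∑ i, p i = 1) (hq1 : ∑ i, q i ≤ 1) (j : ι) :
    (p j - q j) ^ 2 / 4 ≤ relEntropy p q := by
  have hterm : ∀ i, 2 * p i - 2 * (√(p i) * √(q i)) ≤ p i * Real.log (p i / q i) := by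
    intro i
    rcases (hp i).eq_or_lt with h0 | h0
    · simp [← h0]
    have hqi : 0 < q i := (hq i).lt_of_ne fun h => h0.ne' (hac i h.symm)
    have hsp := Real.sqrt_pos.2 h0
    have hsq := Real.sqrt_pos.2 hqi
    have h1 : Real.log (q i / p i) = 2 * Real.log (√(q i) / √(p i)) := by
      rw [← Real.sqrt_div hqi.le, Real.log_sqrt (by positivity)]
      ring
    have h2 := Real.log_le_sub_one_of_pos (div_pos hsq hsp)
    have h3 : Real.log (p i / q i) = - Real.log (q i / p i) := by
      rw [← Real.log_inv, inv_div]
    have h4 : p i * (√(q i) / √(p i)) = √(p i) * √(q i) := by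
      nth_rw 1 [← Real.mul_self_sqrt h0.le]
      field_simp
    rw [h3, h1]
    nlinarith
  have hsum : ∑ i, (√(p i) - √(q i)) ^ 2 ≤ relEntropy p q := by
    have h1 : ∑ i, (√(p i) - √(q i)) ^ 2
        = ∑ i, p i + ∑ i, q i - 2 * ∑ i, √(p i) * √(q i) := by
      rw [← Finset.sum_add_distrib, Finset.mul_sum, ← Finset.sum_sub_distrib]
      refine Finset.sum_congr rfl fun i _ => ?_
      have := Real.sq_sqrt (hp i)
      have := Real.sq_sqrt (hq i)
      nlinarith
    have h2 : 2 * ∑ i, p i - 2 * ∑ i, √(p i) * √(q i) ≤ relEntropy p q := by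
      rw [Finset.mul_sum, Finset.mul_sum, ← Finset.sum_sub_distrib]
      exact Finset.sum_le_sum fun i _ => hterm i
    linarith
  have hj : (√(p j) - √(q j)) ^ 2 ≤ ∑ i, (√(p i) - √(q i)) ^ 2 :=
    Finset.single_le_sum (f := fun i => (√(p i) - √(q i)) ^ 2)
      (fun i _ => sq_nonneg _) (Finset.mem_univ j)
  have hpj : √(p j) ≤ 1 := Real.sqrt_le_one.2
    (hp1 ▸ Finset.single_le_sum (fun i _ => hp i) (Finset.mem_univ j))
  have hqj : √(q j) ≤ 1 := Real.sqrt_le_one.2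
    ((Finset.single_le_sum (fun i _ => hq i) (Finset.mem_univ j)).trans hq1)
  have hfac : (p j - q j) ^ 2 = (√(p j) - √(q j)) ^ 2 * (√(p j) + √(q j)) ^ 2 := by
    rw [← mul_pow, show (√(p j) - √(q j)) * (√(p j) + √(q j))
      = √(p j) ^ 2 - √(q j) ^ 2 by ring, Real.sq_sqrt (hp j), Real.sq_sqrt (hq j)]
  have h4 : (√(p j) + √(q j)) ^ 2 ≤ 4 := by
    nlinarith [Real.sqrt_nonneg (p j), Real.sqrt_nonneg (q j)]
  nlinarith [sq_nonneg (√(p j) - √(q j))]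

/-- Convexity of the relative entropy in its second argument, along the segment that ends at the
first argument, where the relative entropy vanishes. -/
lemma relEntropy_mix_le {p q : ι → ℝ} (hp : ∀ i, 0 ≤ p i) (hq : ∀ i, 0 ≤ q i)
    (hac : ∀ i, q i = 0 → p i = 0) {s : ℝ} (hs0 : 0 ≤ s) (hs1 : s ≤ 1) :
    relEntropy p (fun i => (1 - s) * q i + s * p i) ≤ (1 - s) * relEntropy p q := by
  unfold relEntropy
  rw [Finset.mul_sum]
  refine Finset.sum_le_sum fun i _ => ?_
  rcases (hp i).eq_or_lt with h0 | h0
  · simp [← h0]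
  have hqi : 0 < q i := (hq i).lt_of_ne fun h => h0.ne' (hac i h.symm)
  have hmix : 0 < (1 - s) * q i + s * p i := by
    rcases hs0.eq_or_lt with rfl | hs
    · simpa using hqi
    · have := mul_pos hs h0
      have := mul_nonneg (sub_nonneg.2 hs1) hqi.le
      linarith
  have hconc := strictConcaveOn_log_Ioi.concaveOn.2 (Set.mem_Ioi.2 hqi) (Set.mem_Ioi.2 h0)
    (sub_nonneg.2 hs1) hs0 (by ring)
  simp only [smul_eq_mul] at hconc
  rw [Real.log_div h0.ne' hmix.ne', Real.log_div h0.ne' hqi.ne', mul_left_comm]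
  refine mul_le_mul_of_nonneg_left ?_ h0.le
  linarith

lemma relEntropy_le_sub_log {p q q' : ι → ℝ} (hp : ∀ i, 0 ≤ p i) (hq : ∀ i, 0 ≤ q i)
    (hac : ∀ i, q i = 0 → p i = 0) (hp1 : ∑ i, p i = 1) {s : ℝ} (hs1 : s < 1)
    (hle : ∀ i, (1 - s) * q i ≤ q' i) :
    relEntropy p q' ≤ relEntropy p q - Real.log (1 - s) := by
  have : relEntropy p q - Real.log (1 - s)
      = ∑ i, p i * (Real.log (p i / q i) - Real.log (1 - s)) := by
    simp only [mul_sub, Finset.sum_sub_distrib, ← Finset.sum_mul, hp1, one_mul, relEntropy]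
  rw [this]
  refine Finset.sum_le_sum fun i _ => ?_
  rcases (hp i).eq_or_lt with h0 | h0
  · simp [← h0]
  have hqi : 0 < q i := (hq i).lt_of_ne fun h => h0.ne' (hac i h.symm)
  have h1s : 0 < 1 - s := sub_pos.2 hs1
  have hlog := Real.log_le_log (mul_pos h1s hqi) (hle i)
  rw [Real.log_mul h1s.ne' hqi.ne'] at hlog
  have hq'i : 0 < q' i := (mul_pos h1s hqi).trans_le (hle i)
  rw [Real.log_div h0.ne' hq'i.ne', Real.log_div h0.ne' hqi.ne']
  refine mul_le_mul_of_nonneg_left ?_ h0.le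
  linarith

/-- Since `-log q ≥ 0`, the cross entropy `∑ p (-log q)` is monotone in `p`; this compares the
relative entropies of two first arguments uniformly in the second one. -/
lemma le_relEntropy_of_mul_le {p q r : ι → ℝ} (hq0 : ∀ i, 0 < q i) (hq1 : ∀ i, q i ≤ 1)
    {η : ℝ} (hle : ∀ i, (1 - η) * r i ≤ p i) :
    (1 - η) * (relEntropy r q + ∑ i, Real.negMulLog (r i)) - ∑ i, Real.negMulLog (p i)
      ≤ relEntropy p q := by
  have hsplit : ∀ u : ι → ℝ, relEntropy u q + ∑ i, Real.negMulLog (u i)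
      = ∑ i, u i * (-Real.log (q i)) := by
    intro u
    unfold relEntropy
    rw [← Finset.sum_add_distrib]
    refine Finset.sum_congr rfl fun i _ => ?_
    rcases eq_or_ne (u i) 0 with h0 | h0
    · simp [h0]
    · rw [Real.log_div h0 (hq0 i).ne', Real.negMulLog]
      ring
  have h : (1 - η) * (relEntropy r q + ∑ i, Real.negMulLog (r i))
      ≤ relEntropy p q + ∑ i, Real.negMulLog (p i) := by
    rw [hsplit, hsplit, Finset.mul_sum]
    refine Finset.sum_le_sum fun i _ => ?_
    rw [← mul_assoc]
    exact mul_le_mul_of_nonneg_right (hle i)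
      (neg_nonneg.2 (Real.log_nonpos (hq0 i).le (hq1 i)))
  linarith

end RelEntropy

/-! ### Finitely supported measures -/

/-- The masses that `ν` gives to the points of the finite set `S`. -/
def weights (S : Finset ℝ) (ν : Measure ℝ) (x : S) : ℝ := ν.real {(x : ℝ)}

lemma weights_nonneg (S : Finset ℝ) (ν : Measure ℝ) (x : S) : 0 ≤ weights S ν x :=
  measureReal_nonneg

lemma weights_le_one (S : Finset ℝ) (ν : Measure ℝ) [IsProbabilityMeasure ν] (x : S) :
    weights S ν x ≤ 1 := measureReal_le_one

lemma sum_weights (S : Finset ℝ) (ν : Measure ℝ) [IsFiniteMeasure ν] :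
    ∑ x, weights S ν x = ν.real (S : Set ℝ) := by
  rw [← sum_measureReal_singleton]
  exact Finset.sum_coe_sort S fun x => ν.real {x}

lemma integral_eq_sum_weights {S : Finset ℝ} {ν : Measure ℝ} [IsFiniteMeasure ν]
    (hS : ν (S : Set ℝ)ᶜ = 0) (g : ℝ → ℝ) :
    Integrable g ν ∧ ∫ x, g x ∂ν = ∑ x, weights S ν x * g x := by
  have hr : ν.restrict (S : Set ℝ) = ν := Measure.restrict_eq_self_of_ae_mem (by
    rwa [ae_iff])
  have hi : IntegrableOn g (S : Set ℝ) ν := IntegrableOn.finset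
  refine ⟨hr ▸ hi, ?_⟩
  conv_lhs => rw [← hr]
  rw [setIntegral_finset _ hi, ← Finset.sum_coe_sort]
  rfl

lemma sum_weights_eq_one {S : Finset ℝ} {ν : Measure ℝ} [IsProbabilityMeasure ν]
    (hS : ν (S : Set ℝ)ᶜ = 0) : ∑ x, weights S ν x = 1 := by
  have := (integral_eq_sum_weights hS fun _ => 1).2
  simpa using this.symm

lemma sum_weights_le_one (S : Finset ℝ) (ν : Measure ℝ) [IsProbabilityMeasure ν] :
    ∑ x, weights S ν x ≤ 1 := by
  rw [sum_weights]
  exact measureReal_le_one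

lemma mean_eq_sum_weights {S : Finset ℝ} {ν : Measure ℝ} [IsFiniteMeasure ν]
    (hS : ν (S : Set ℝ)ᶜ = 0) : mean ν = ∑ x, weights S ν x * x :=
  (integral_eq_sum_weights hS fun x => x).2

lemma absolutelyContinuous_iff_weights {S : Finset ℝ} {p : Measure ℝ} [IsFiniteMeasure p]
    (hS : p (S : Set ℝ)ᶜ = 0) (q : Measure ℝ) [IsFiniteMeasure q] :
    p ≪ q ↔ ∀ x, weights S q x = 0 → weights S p x = 0 := by
  constructor
  · intro h x hx
    rw [weights, measureReal_eq_zero_iff] at hx ⊢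
    exact h hx
  · intro h s hs
    refine measure_mono_null (t := (S : Set ℝ)ᶜ ∪ ⋃ x ∈ S, s ∩ {x}) ?_ ?_
    · intro x hx
      by_cases hxS : x ∈ S
      · right
        simp [hx, hxS]
      · left
        simpa using hxS
    · refine measure_union_null hS ((measure_biUnion_null_iff S.countable_toSet).2 ?_)
      intro x hxS
      by_cases hx : x ∈ s
      · refine measure_mono_null Set.inter_subset_right ?_
        have := h ⟨x, hxS⟩
        rw [weights, weights, measureReal_eq_zero_iff, measureReal_eq_zero_iff] at this
        exact this (measure_mono_null (by simpa using hx) hs)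
      · rw [Set.inter_singleton_eq_empty.2 hx, measure_empty]

lemma klDiv_eq_ofReal_relEntropy {S : Finset ℝ} {p q : Measure ℝ} [IsProbabilityMeasure p]
    [IsProbabilityMeasure q] (hS : p (S : Set ℝ)ᶜ = 0) (hpq : p ≪ q) :
    InformationTheory.klDiv p q = ENNReal.ofReal (relEntropy (weights S p) (weights S q)) := by
  obtain ⟨hi, heq⟩ := integral_eq_sum_weights hS (llr p q)
  rw [InformationTheory.klDiv_of_ac_of_integrable hpq hi, heq]
  simp only [probReal_univ, add_sub_cancel_right]
  congr 1
  refine Finset.sum_congr rfl fun x _ => ?_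
  have h : p.rnDeriv q x * q {(x : ℝ)} = p {(x : ℝ)} := by
    rw [← Measure.setLIntegral_rnDeriv hpq, lintegral_singleton]
  have h' : (p.rnDeriv q x).toReal * weights S q x = weights S p x := by
    rw [weights, weights, measureReal_def, measureReal_def, ← h, ENNReal.toReal_mul]
  rcases eq_or_ne (weights S q x) 0 with h0 | h0
  · rw [h0, mul_zero] at h'
    simp [← h']
  · rw [llr, ← h', mul_div_cancel_right₀ _ h0]

/-- The mixture `(1 - s) ν + s ν'`. -/
def mix (s : ℝ) (ν ν' : Measure ℝ) : Measure ℝ :=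
  ENNReal.ofReal (1 - s) • ν + ENNReal.ofReal s • ν'

lemma mix_real {s : ℝ} (hs0 : 0 ≤ s) (hs1 : s ≤ 1) (ν ν' : Measure ℝ) [IsFiniteMeasure ν]
    [IsFiniteMeasure ν'] (B : Set ℝ) :
    (mix s ν ν').real B = (1 - s) * ν.real B + s * ν'.real B := by
  rw [mix, measureReal_def, Measure.add_apply, Measure.smul_apply, Measure.smul_apply,
    smul_eq_mul, smul_eq_mul, ENNReal.toReal_add (by finiteness) (by finiteness),
    ENNReal.toReal_mul, ENNReal.toReal_mul, ENNReal.toReal_ofReal (sub_nonneg.2 hs1),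
    ENNReal.toReal_ofReal hs0, measureReal_def, measureReal_def]

lemma mix_mem_finSuppDist {s : ℝ} (hs0 : 0 ≤ s) (hs1 : s ≤ 1) {ν ν' : Measure ℝ}
    (hν : ν ∈ finSuppDist) (hν' : ν' ∈ finSuppDist) :
    mix s ν ν' ∈ finSuppDist ∧ mean (mix s ν ν') = (1 - s) * mean ν + s * mean ν' := by
  obtain ⟨hP, S, hS, hS0⟩ := hν
  obtain ⟨hP', S', hS', hS0'⟩ := hν'
  refine ⟨⟨⟨?_⟩, S ∪ S', ?_, ?_⟩, ?_⟩
  · rw [mix, Measure.add_apply, Measure.smul_apply, Measure.smul_apply, measure_univ,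
      measure_univ, smul_eq_mul, smul_eq_mul, mul_one, mul_one,
      ← ENNReal.ofReal_add (sub_nonneg.2 hs1) hs0]
    simp
  · simpa using ⟨hS, hS'⟩
  · rw [mix, Measure.add_apply, Measure.smul_apply, Measure.smul_apply,
      measure_mono_null (Set.compl_subset_compl.2 (by simp)) hS0,
      measure_mono_null (Set.compl_subset_compl.2 (by simp)) hS0']
    simp
  · rw [mean, mix, integral_add_measure, integral_smul_measure, integral_smul_measure,
      ENNReal.toReal_ofReal (sub_nonneg.2 hs1), ENNReal.toReal_ofReal hs0]
    · rfl
    · exact (integral_eq_sum_weights hS0 _).1.smul_measure (by finiteness)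
    · exact (integral_eq_sum_weights hS0' _).1.smul_measure (by finiteness)

lemma dirac_one_mem_finSuppDist : Measure.dirac (1 : ℝ) ∈ finSuppDist :=
  ⟨inferInstance, {1}, by simp, by simp⟩

lemma mean_dirac_one : mean (Measure.dirac (1 : ℝ)) = 1 := by
  simp [mean]

lemma mean_mem_Icc {ν : Measure ℝ} (hν : ν ∈ finSuppDist) : mean ν ∈ Set.Icc (0 : ℝ) 1 := by
  obtain ⟨hP, S, hS, hS0⟩ := hν
  rw [mean_eq_sum_weights hS0]
  refine ⟨Finset.sum_nonneg fun x _ => mul_nonneg (weights_nonneg _ _ _) (hS x.2).1, ?_⟩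
  rw [← sum_weights_eq_one hS0]
  exact Finset.sum_le_sum fun x _ => mul_le_of_le_one_right (weights_nonneg _ _ _) (hS x.2).2

/-- A finitely supported distribution on `[0,1]` is carried by its finitely many atoms. -/
lemma exists_support_of_mem_finSuppDist {ν : Measure ℝ} (hν : ν ∈ finSuppDist) :
    ∃ S : Finset ℝ, (S : Set ℝ) ⊆ Set.Icc 0 1 ∧ ν (S : Set ℝ)ᶜ = 0 ∧
      ∀ x, 0 < weights S ν x := by
  obtain ⟨hP, S, hS, hS0⟩ := hν
  classical
  refine ⟨S.filter fun x => ν {x} ≠ 0, fun x hx => hS (Finset.mem_filter.1 hx).1, ?_, ?_⟩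
  · refine measure_mono_null (t := (S : Set ℝ)ᶜ ∪ ⋃ x ∈ S.filter fun x => ν {x} = 0, {x}) ?_
      (measure_union_null hS0 ((measure_biUnion_null_iff (Finset.countable_toSet _)).2 ?_))
    · intro x hx
      simp only [Finset.coe_filter, Set.mem_compl_iff, Set.mem_ofPred_eq, not_and, not_not] at hx
      by_cases hxS : x ∈ S
      · right
        simp [hxS, hx hxS]
      · left
        simpa using hxS
    · intro x hx
      exact (Finset.mem_filter.1 hx).2
  · intro x
    exact measureReal_nonneg.lt_of_ne fun h =>
      (Finset.mem_filter.1 x.2).2 ((measureReal_eq_zero_iff).1 h.symm)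

/-! ### The function `Kinf` -/

lemma Kinf_mono (p : Measure ℝ) {μ μ' : ℝ} (h : μ ≤ μ') : Kinf p μ ≤ Kinf p μ' :=
  le_iInf₂ fun q hq => iInf₂_le q ⟨hq.1, h.trans_lt hq.2⟩

lemma Kinf_eq_zero_of_lt_mean {p : Measure ℝ} (hp : p ∈ finSuppDist) {μ : ℝ} (h : μ < mean p) :
    Kinf p μ = 0 := by
  have := hp.1
  refine le_antisymm ?_ zero_le
  rw [← InformationTheory.klDiv_self p]
  exact iInf₂_le p ⟨hp, h⟩

lemma Kinf_le_relEntropy {S : Finset ℝ} {p q : Measure ℝ} [IsProbabilityMeasure p]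
    (hS : p (S : Set ℝ)ᶜ = 0) (hq : q ∈ finSuppDist) {μ : ℝ} (hμ : μ < mean q)
    (hac : ∀ x, weights S q x = 0 → weights S p x = 0) :
    Kinf p μ ≤ ENNReal.ofReal (relEntropy (weights S p) (weights S q)) := by
  have := hq.1
  rw [← klDiv_eq_ofReal_relEntropy hS ((absolutelyContinuous_iff_weights hS q).2 hac)]
  exact iInf₂_le q ⟨hq, hμ⟩

lemma le_Kinf {S : Finset ℝ} {p : Measure ℝ} [IsProbabilityMeasure p]
    (hS : p (S : Set ℝ)ᶜ = 0) {μ C : ℝ}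
    (h : ∀ q ∈ finSuppDist, μ < mean q → (∀ x, weights S q x = 0 → weights S p x = 0) →
      C ≤ relEntropy (weights S p) (weights S q)) :
    ENNReal.ofReal C ≤ Kinf p μ := by
  refine le_iInf₂ fun q hq => ?_
  have := hq.1.1
  by_cases hpq : p ≪ q
  · rw [klDiv_eq_ofReal_relEntropy hS hpq]
    exact ENNReal.ofReal_le_ofReal
      (h q hq.1 hq.2 ((absolutelyContinuous_iff_weights hS q).1 hpq))
  · rw [InformationTheory.klDiv_of_not_ac hpq]
    exact le_top

/-- The points outside `S` contribute a nonnegative amount to the mean `1 - mean q` of `1 - x`. -/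
lemma sum_weights_mul_one_sub_le {S : Finset ℝ} {q : Measure ℝ} (hq : q ∈ finSuppDist) :
    ∑ x, weights S q x * (1 - x) ≤ 1 - mean q := by
  obtain ⟨hP, S', hS', hS0'⟩ := hq
  have hi := (integral_eq_sum_weights hS0' fun x => 1 - x).1
  have h1 : ∫ x, (1 - x) ∂q = 1 - mean q := by
    rw [integral_sub (integrable_const _) (integral_eq_sum_weights hS0' fun x => x).1, mean]
    simp
  rw [← h1]
  refine le_trans (le_of_eq ?_)
    (setIntegral_le_integral (s := (S : Set ℝ)) hi ?_)
  · rw [setIntegral_finset _ hi.integrableOn]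
    exact Finset.sum_coe_sort S fun x => q.real {x} * (1 - x)
  · have : ∀ᵐ x ∂q, x ∈ (S' : Set ℝ) := by rwa [ae_iff]
    filter_upwards [this] with x hx
    simpa using (hS' hx).2

/-- A distribution whose mean exceeds the mean of `p` by `d` is far from `p` in relative
entropy. -/
lemma relEntropy_ge_of_mean_sub {S : Finset ℝ} (hSI : (S : Set ℝ) ⊆ Set.Icc 0 1)
    {p q : Measure ℝ} [IsProbabilityMeasure p] (hS : p (S : Set ℝ)ᶜ = 0) (hq : q ∈ finSuppDist)
    (hac : ∀ x, weights S q x = 0 → weights S p x = 0) {d : ℝ} (hd : 0 ≤ d)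
    (hdm : d ≤ mean q - mean p) :
    (d / S.card) ^ 2 / 4 ≤ relEntropy (weights S p) (weights S q) := by
  have := hq.1
  have hSne : S.Nonempty := by
    rw [Finset.nonempty_iff_ne_empty]
    rintro rfl
    simp at hS
  have hcard : (0 : ℝ) < S.card := by exact_mod_cast hSne.card_pos
  have hmp : mean p = 1 - ∑ x, weights S p x * (1 - x) := by
    simp only [mul_sub, mul_one, Finset.sum_sub_distrib, sum_weights_eq_one hS,
      mean_eq_sum_weights hS]
    ring
  have hsum : ∑ _x : S, d / S.card ≤ ∑ x, |weights S p x - weights S q x| := by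
    have h1 : ∑ _x : S, d / S.card = d := by
      rw [Finset.sum_const, Finset.card_univ, Fintype.card_coe, nsmul_eq_mul]
      field_simp
    have h2 : d ≤ ∑ x, (weights S p x - weights S q x) * (1 - x) := by
      have := sum_weights_mul_one_sub_le (S := S) hq
      simp only [sub_mul, Finset.sum_sub_distrib]
      linarith
    rw [h1]
    refine h2.trans (Finset.sum_le_sum fun x _ => ?_)
    have hx := hSI x.2
    calc (weights S p x - weights S q x) * (1 - x)
        ≤ |weights S p x - weights S q x| * (1 - x) :=
          mul_le_mul_of_nonneg_right (le_abs_self _) (by linarith [hx.2])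
      _ ≤ |weights S p x - weights S q x| :=
          mul_le_of_le_one_right (abs_nonneg _) (by linarith [hx.1])
  obtain ⟨x, -, hx⟩ := Finset.exists_le_of_sum_le
    (⟨⟨_, hSne.choose_spec⟩, Finset.mem_univ _⟩ : (Finset.univ : Finset S).Nonempty) hsum
  refine le_trans ?_ (sq_sub_div_four_le_relEntropy (weights_nonneg S p) (weights_nonneg S q) hac
    (sum_weights_eq_one hS) (sum_weights_le_one S q) x)
  rw [← sq_abs (weights S p x - weights S q x)]
  gcongr

lemma Kinf_pos {ν : Measure ℝ} (hν : ν ∈ finSuppDist) {μ : ℝ} (h : mean ν < μ) :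
    0 < Kinf ν μ := by
  obtain ⟨hP, S, hSI, hS⟩ := hν
  have hSne : S.Nonempty := by
    rw [Finset.nonempty_iff_ne_empty]
    rintro rfl
    simp at hS
  have hcard : (0 : ℝ) < S.card := by exact_mod_cast hSne.card_pos
  have hd : 0 < μ - mean ν := sub_pos.2 h
  refine lt_of_lt_of_le (ENNReal.ofReal_pos.2 (?_ : 0 < ((μ - mean ν) / S.card) ^ 2 / 4))
    (le_Kinf hS fun q hq hμq hac => relEntropy_ge_of_mean_sub hSI hS hq hac hd.le (by linarith))
  positivity

/-- Moving a fraction `s` of the mass to the point `1` raises the mean above `μ`, at the bounded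
cost `-log (1 - s)`. -/
lemma Kinf_lt_top {ν : Measure ℝ} (hν : ν ∈ finSuppDist) {μ : ℝ} (h0 : 0 ≤ μ) (h1 : μ < 1) :
    Kinf ν μ < ∞ := by
  obtain ⟨hP, S, hSI, hS⟩ := id hν
  obtain ⟨hmem, hmean⟩ := mix_mem_finSuppDist (s := (μ + 1) / 2) (by linarith) (by linarith) hν
    dirac_one_mem_finSuppDist
  refine (Kinf_le_relEntropy hS hmem ?_ ?_).trans_lt ENNReal.ofReal_lt_top
  · rw [hmean, mean_dirac_one]
    have := mul_nonneg (by linarith : 0 ≤ 1 - (μ + 1) / 2) (mean_mem_Icc hν).1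
    linarith
  · intro x hx
    rw [weights, mix_real (by linarith) (by linarith)] at hx
    have h2 : 0 ≤ (μ + 1) / 2 * (Measure.dirac (1 : ℝ)).real {(x : ℝ)} :=
      mul_nonneg (by linarith) measureReal_nonneg
    have h3 := weights_nonneg S ν x
    rw [weights] at h3 ⊢
    have h4 : 0 < 1 - (μ + 1) / 2 := by linarith
    nlinarith

/-- Lower semicontinuity of `Kinf` at `(ν, μ)`, along distributions carried by the support of `ν`.
A competitor `q` of `p` near `ν` yields the competitor `(1 - s) q + s δ₁` of `ν`, and the relative
entropies of the two are compared through `le_relEntropy_of_mul_le` and `relEntropy_le_sub_log`. -/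
lemma exists_eventually_le_Kinf {S : Finset ℝ} {ν : Measure ℝ} (hν : ν ∈ finSuppDist)
    (hS : ν (S : Set ℝ)ᶜ = 0) (hpos : ∀ x, 0 < weights S ν x) {μ C : ℝ} (h0 : 0 ≤ μ) (h1 : μ < 1)
    (hC0 : 0 ≤ C) (hC : C < (Kinf ν μ).toReal) :
    ∃ ε > 0, ∀ᶠ w in nhds (weights S ν), ∀ p : Measure ℝ, IsProbabilityMeasure p →
      p (S : Set ℝ)ᶜ = 0 → weights S p = w → ENNReal.ofReal C ≤ Kinf p (μ - ε) := by
  have hνP := hν.1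
  set K := (Kinf ν μ).toReal with hK
  have hKfin : Kinf ν μ ≠ ∞ := (Kinf_lt_top hν h0 h1).ne
  set H : ℝ := ∑ x, Real.negMulLog (weights S ν x) with hH
  have hH0 : 0 ≤ H := Finset.sum_nonneg fun x _ =>
    Real.negMulLog_nonneg (weights_nonneg _ _ _) (weights_le_one _ _ _)
  obtain ⟨d, hd, hd3⟩ : ∃ d > 0, C = K - 3 * d := ⟨(K - C) / 3, by linarith, by ring⟩
  -- the fraction `s` costs `-log (1 - s) = d`
  obtain ⟨s, hs0, hs1, hsd⟩ : ∃ s : ℝ, 0 < s ∧ s < 1 ∧ Real.log (1 - s) = -d :=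
    ⟨1 - Real.exp (-d), by simpa using hd, by simpa using Real.exp_pos _, by simp⟩
  obtain ⟨η, hη0, hη1, hηd⟩ : ∃ η : ℝ, 0 < η ∧ η ≤ 1 ∧ η * (K + H) ≤ d := by
    have hden : 0 < K + H + d := by linarith
    refine ⟨d / (K + H + d), by positivity, (div_le_one hden).2 (by linarith), ?_⟩
    rw [div_mul_eq_mul_div, div_le_iff₀ hden]
    nlinarith
  refine ⟨s * (1 - μ), mul_pos hs0 (sub_pos.2 h1), ?_⟩
  have hev1 : ∀ᶠ w in nhds (weights S ν), ∀ x, (1 - η) * weights S ν x < w x := by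
    rw [eventually_all]
    intro x
    refine (continuous_apply x).continuousAt.eventually_const_lt ?_
    nlinarith [hpos x]
  have hev2 : ∀ᶠ w in nhds (weights S ν), ∑ x, Real.negMulLog (w x) < H + d := by
    have hcont : Continuous fun w : S → ℝ => ∑ x, Real.negMulLog (w x) := by fun_prop
    exact hcont.continuousAt.eventually_lt_const (by simpa [hH] using hd)
  filter_upwards [hev1, hev2] with w hw1 hw2 p hpP hpS hpw
  subst hpw
  refine le_Kinf hpS fun q hq hμq hac => ?_
  have hqP := hq.1
  have hppos : ∀ x, 0 < weights S p x := fun x =>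
    (mul_nonneg (sub_nonneg.2 hη1) (hpos x).le).trans_lt (hw1 x)
  have hqpos : ∀ x, 0 < weights S q x := fun x =>
    (weights_nonneg S q x).lt_of_ne fun h => (hppos x).ne' (hac x h.symm)
  have hmain := le_relEntropy_of_mul_le hqpos (weights_le_one S q) (fun x => (hw1 x).le)
  obtain ⟨hmem, hmean⟩ := mix_mem_finSuppDist hs0.le hs1.le hq dirac_one_mem_finSuppDist
  have hle : ∀ x, (1 - s) * weights S q x ≤ weights S (mix s q (Measure.dirac 1)) x := by
    intro x
    rw [weights, weights, mix_real hs0.le hs1.le]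
    have : 0 ≤ s * (Measure.dirac (1 : ℝ)).real {(x : ℝ)} := mul_nonneg hs0.le measureReal_nonneg
    linarith
  have hmixpos : ∀ x, 0 < weights S (mix s q (Measure.dirac 1)) x := fun x =>
    (mul_pos (sub_pos.2 hs1) (hqpos x)).trans_le (hle x)
  have hcost := relEntropy_le_sub_log (weights_nonneg S ν) (weights_nonneg S q)
    (fun x h => absurd h (hqpos x).ne') (sum_weights_eq_one hS) hs1 hle
  have hKle : Kinf ν μ ≤ _ := Kinf_le_relEntropy hS hmem
    (by rw [hmean, mean_dirac_one]; nlinarith [mul_pos hs0 (mul_pos hs0 (sub_pos.2 h1))])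
    (fun x h => absurd h (hmixpos x).ne')
  have hKpos : 0 < K := hC0.trans_lt hC
  have hKle' : K ≤ relEntropy (weights S ν) (weights S (mix s q (Measure.dirac 1))) := by
    by_contra! hlt
    have h2 := (ENNReal.le_ofReal_iff_toReal_le hKfin ?_).1 hKle
    · exact absurd h2 (not_le.2 hlt)
    · by_contra! hneg
      rw [ENNReal.ofReal_of_nonpos hneg.le] at hKle
      rw [hK, le_antisymm hKle zero_le] at hKpos
      simp at hKpos
  have hfin : K - d ≤ relEntropy (weights S ν) (weights S q) := by linarith
  have hscaled : (1 - η) * (K - d + H)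
      ≤ (1 - η) * (relEntropy (weights S ν) (weights S q) + H) :=
    mul_le_mul_of_nonneg_left (by linarith) (sub_nonneg.2 hη1)
  nlinarith [mul_pos hη0 hd]

/-- If `Kinf p (μ - ε)` is well below `Kinf ν μ`, then `p` is far from `ν` in relative entropy. -/
lemma exists_relEntropy_ge_of_Kinf_lt {S : Finset ℝ} {ν : Measure ℝ} (hν : ν ∈ finSuppDist)
    (hS : ν (S : Set ℝ)ᶜ = 0) (hpos : ∀ x, 0 < weights S ν x) {μ C : ℝ} (h0 : 0 ≤ μ) (h1 : μ < 1)
    (hC0 : 0 ≤ C) (hC : C < (Kinf ν μ).toReal) :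
    ∃ ε > 0, ∃ δ > 0, ∀ p : Measure ℝ, IsProbabilityMeasure p → p (S : Set ℝ)ᶜ = 0 →
      Kinf p (μ - ε) < ENNReal.ofReal C → δ ≤ relEntropy (weights S p) (weights S ν) := by
  have := hν.1
  obtain ⟨ε, hε, hev⟩ := exists_eventually_le_Kinf hν hS hpos h0 h1 hC0 hC
  obtain ⟨ρ, hρ, hball⟩ := Metric.eventually_nhds_iff.1 hev
  refine ⟨ε, hε, ρ ^ 2 / 4, by positivity, fun p hp hpS hlt => ?_⟩
  have hfar : ¬ dist (weights S p) (weights S ν) < ρ := fun h =>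
    absurd hlt (not_lt.2 (hball h p hp hpS rfl))
  rw [dist_pi_lt_iff hρ] at hfar
  push Not at hfar
  obtain ⟨x, hx⟩ := hfar
  refine le_trans ?_ (sq_sub_div_four_le_relEntropy (weights_nonneg S p) (weights_nonneg S ν)
    (fun x h => absurd h (hpos x).ne') (sum_weights_eq_one hpS) (sum_weights_le_one S ν) x)
  rw [Real.dist_eq] at hx
  rw [← sq_abs (weights S p x - weights S ν x)]
  gcongr

/-- The gap between the relative entropy with respect to `ν` and `Kinf` at a level below the mean
of `ν`: the mixture `(1 - s) ν + s p` is still a competitor of `p`, and its relative entropy is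
smaller by the factor `1 - s`. -/
lemma exists_Kinf_le_mul_relEntropy {S : Finset ℝ} {ν : Measure ℝ} (hν : ν ∈ finSuppDist)
    (hSI : (S : Set ℝ) ⊆ Set.Icc 0 1) (hpos : ∀ x, 0 < weights S ν x) {ε : ℝ} (hε : 0 < ε)
    (hε1 : ε < 1) :
    ∃ s > 0, ∃ δ > 0, ∀ p : Measure ℝ, IsProbabilityMeasure p → p (S : Set ℝ)ᶜ = 0 →
      mean p ≤ mean ν - ε →
      Kinf p (mean ν - ε) ≤ ENNReal.ofReal ((1 - s) * relEntropy (weights S p) (weights S ν)) ∧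
      δ ≤ s * relEntropy (weights S p) (weights S ν) := by
  have := hν.1
  have hac : ∀ p : Measure ℝ, ∀ x, weights S ν x = 0 → weights S p x = 0 :=
    fun p x h => absurd h (hpos x).ne'
  rcases S.eq_empty_or_nonempty with rfl | hSne
  · exact ⟨1, one_pos, 1, one_pos, fun p hp hpS => by simp at hpS⟩
  have hcard : (0 : ℝ) < S.card := by exact_mod_cast hSne.card_pos
  refine ⟨ε / 2, by positivity, ε / 2 * ((ε / S.card) ^ 2 / 4), by positivity,
    fun p hp hpS hpm => ⟨?_, ?_⟩⟩
  · have hpF : p ∈ finSuppDist := ⟨hp, S, hSI, hpS⟩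
    have hs0 : 0 ≤ ε / 2 := by positivity
    have hs1 : ε / 2 ≤ 1 := by linarith
    obtain ⟨hmem, hmean⟩ := mix_mem_finSuppDist hs0 hs1 hν hpF
    have hw : weights S (mix (ε / 2) ν p)
        = fun x => (1 - ε / 2) * weights S ν x + ε / 2 * weights S p x := by
      funext x
      exact mix_real hs0 hs1 ν p _
    refine (Kinf_le_relEntropy hpS hmem ?_ ?_).trans (ENNReal.ofReal_le_ofReal ?_)
    · rw [hmean]
      have h1 := (mean_mem_Icc hν).2
      have h2 := (mean_mem_Icc hpF).1
      nlinarith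
    · intro x hx
      rw [hw] at hx
      have h1 := mul_pos (by linarith : 0 < 1 - ε / 2) (hpos x)
      have h2 := mul_nonneg hs0 (weights_nonneg S p x)
      linarith
    · rw [hw]
      exact relEntropy_mix_le (weights_nonneg S p) (weights_nonneg S ν) (hac p) hs0 hs1
  · exact mul_le_mul_of_nonneg_left
      (relEntropy_ge_of_mean_sub hSI hpS hν (hac p) hε.le (by linarith)) (by positivity)

/-! ### Pulls and empirical types -/

section Types

variable {𝒜 : Type*} [DecidableEq 𝒜] {Ω : Type*}

lemma pullRounds_succ (A : ℕ → Ω → 𝒜) (a : 𝒜) (t : ℕ) (ω : Ω) :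
    pullRounds A a (t + 1) ω
      = if A (t + 1) ω = a then insert (t + 1) (pullRounds A a t ω) else pullRounds A a t ω := by
  rw [pullRounds, ← Finset.insert_Icc_right_eq_Icc_add_one (by omega), Finset.filter_insert]
  rfl

lemma notMem_pullRounds_succ (A : ℕ → Ω → 𝒜) (a : 𝒜) (t : ℕ) (ω : Ω) :
    t + 1 ∉ pullRounds A a t ω := by
  simp [pullRounds]

lemma numPulls_succ (A : ℕ → Ω → 𝒜) (a : 𝒜) (t : ℕ) (ω : Ω) :
    numPulls A a (t + 1) ω = numPulls A a t ω + if A (t + 1) ω = a then 1 else 0 := by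
  rw [numPulls, pullRounds_succ]
  split_ifs
  · rw [Finset.card_insert_of_notMem (notMem_pullRounds_succ A a t ω), numPulls]
  · rfl

lemma numPulls_mono (A : ℕ → Ω → 𝒜) (a : 𝒜) (ω : Ω) : Monotone fun t => numPulls A a t ω :=
  monotone_nat_of_le_succ fun t => by simp only [numPulls_succ]; omega

lemma numPulls_le (A : ℕ → Ω → 𝒜) (a : 𝒜) (t : ℕ) (ω : Ω) : numPulls A a t ω ≤ t :=
  (Finset.card_filter_le _ _).trans (by simp)

lemma numPulls_injOn (A : ℕ → Ω → 𝒜) (a : 𝒜) (ω : Ω) :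
    Set.InjOn (fun t => numPulls A a t ω) {t | A (t + 1) ω = a} := by
  have key : ∀ s t, A (s + 1) ω = a → s < t → numPulls A a s ω < numPulls A a t ω := by
    intro s t hs hst
    have h1 := numPulls_mono A a ω (Nat.succ_le_of_lt hst)
    have h2 := numPulls_succ A a s ω
    rw [if_pos hs] at h2
    simp only [Nat.succ_eq_add_one] at h1
    omega
  intro s hs t ht hst
  rcases lt_trichotomy s t with h | h | h
  · exact absurd hst (key s t hs h).ne
  · exact h
  · exact absurd hst (key t s ht h).ne'

lemma numPulls_eq_sum_indicator (A : ℕ → Ω → 𝒜) (a : 𝒜) (T : ℕ) (ω : Ω) :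
    (numPulls A a T ω : ℝ)
      = ∑ t ∈ Finset.range T, {ω | A (t + 1) ω = a}.indicator (fun _ => (1 : ℝ)) ω := by
  induction T with
  | zero => simp [numPulls, pullRounds]
  | succ T ih =>
    rw [Finset.sum_range_succ, ← ih, numPulls_succ, Nat.cast_add]
    by_cases h : A (T + 1) ω = a <;> simp [h]

/-- The type of the payoffs of the arm `a` in the rounds `1, …, t`: the number of times each point
of `S` has been received. -/
def pullType (S : Finset ℝ) (A : ℕ → Ω → 𝒜) (Y : ℕ → Ω → ℝ) (a : 𝒜) (t : ℕ) (ω : Ω) (x : S) : ℕ :=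
  ((pullRounds A a t ω).filter fun s => Y s ω = x).card

/-- The weights of the empirical distribution with type `k`. -/
def typeWeights {S : Finset ℝ} (k : S → ℕ) (x : S) : ℝ := k x / (∑ y, k y : ℕ)

lemma sum_pullType {S : Finset ℝ} {A : ℕ → Ω → 𝒜} {Y : ℕ → Ω → ℝ} {a : 𝒜} {ω : Ω}
    (hω : ∀ t, A (t + 1) ω = a → Y (t + 1) ω ∈ S) (t : ℕ) :
    ∑ x, pullType S A Y a t ω x = numPulls A a t ω := by
  rw [numPulls, Finset.card_eq_sum_card_fiberwise (f := fun s => Y s ω) (t := S)]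
  · exact Finset.sum_coe_sort S fun x => ((pullRounds A a t ω).filter fun s => Y s ω = x).card
  · intro s hs
    obtain ⟨h1, h2⟩ := Finset.mem_filter.1 hs
    obtain ⟨r, rfl⟩ : ∃ r, s = r + 1 := ⟨s - 1, by have := (Finset.mem_Icc.1 h1).1; omega⟩
    exact hω r h2

lemma empDist_eq_of_type {S : Finset ℝ} {A : ℕ → Ω → 𝒜} {Y : ℕ → Ω → ℝ} {a : 𝒜} {ω : Ω}
    (hω : ∀ t, A (t + 1) ω = a → Y (t + 1) ω ∈ S) {t : ℕ} (hn : numPulls A a t ω ≠ 0) :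
    IsProbabilityMeasure (empDist A Y a t ω) ∧ empDist A Y a t ω (S : Set ℝ)ᶜ = 0 ∧
      weights S (empDist A Y a t ω) = typeWeights (pullType S A Y a t ω) := by
  have happ : ∀ B : Set ℝ, MeasurableSet B → empDist A Y a t ω B
      = (numPulls A a t ω : ℝ≥0∞)⁻¹ * ∑ s ∈ pullRounds A a t ω, B.indicator 1 (Y s ω) := by
    intro B hB
    simp [empDist, Measure.finsetSum_apply, Measure.dirac_apply' _ hB]
  refine ⟨⟨?_⟩, ?_, ?_⟩
  · rw [happ _ MeasurableSet.univ]
    simp only [Set.indicator_univ, Pi.one_apply, Finset.sum_const, nsmul_eq_mul, mul_one]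
    exact ENNReal.inv_mul_cancel (by exact_mod_cast hn) (by finiteness)
  · rw [happ _ S.measurableSet.compl, Finset.sum_eq_zero, mul_zero]
    intro s hs
    obtain ⟨h1, h2⟩ := Finset.mem_filter.1 hs
    obtain ⟨r, rfl⟩ : ∃ r, s = r + 1 := ⟨s - 1, by have := (Finset.mem_Icc.1 h1).1; omega⟩
    simpa using hω r h2
  · funext x
    rw [weights, measureReal_def, happ _ (measurableSet_singleton _), typeWeights,
      sum_pullType hω]
    have : ∑ s ∈ pullRounds A a t ω, ({(x : ℝ)} : Set ℝ).indicator 1 (Y s ω)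
        = (pullType S A Y a t ω x : ℝ≥0∞) := by
      simp [pullType, Set.indicator_apply]
    rw [this, ENNReal.toReal_mul, ENNReal.toReal_inv, ENNReal.toReal_natCast,
      ENNReal.toReal_natCast]
    ring

/-- The product of `g` over the payoffs of the first `n` pulls of the arm `a`, as far as these
occur in the rounds `1, …, t`. -/
def pullProd (g : ℝ → ℝ) (A : ℕ → Ω → 𝒜) (Y : ℕ → Ω → ℝ) (a : 𝒜) (n t : ℕ) (ω : Ω) : ℝ :=
  ∏ s ∈ Finset.range t, if A (s + 1) ω = a ∧ numPulls A a s ω < n then g (Y (s + 1) ω) else 1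

lemma pullProd_eq_prod_pow (g : ℝ → ℝ) {S : Finset ℝ} {A : ℕ → Ω → 𝒜} {Y : ℕ → Ω → ℝ} {a : 𝒜}
    {ω : Ω} (hω : ∀ t, A (t + 1) ω = a → Y (t + 1) ω ∈ S) {t T : ℕ} (htT : t ≤ T) :
    pullProd g A Y a (numPulls A a t ω) T ω = ∏ x : S, g x ^ pullType S A Y a t ω x := by
  have h1 : pullProd g A Y a (numPulls A a t ω) T ω
      = ∏ s ∈ Finset.range t, if A (s + 1) ω = a then g (Y (s + 1) ω) else 1 := by
    rw [pullProd, ← Finset.prod_subset (Finset.range_subset_range.2 htT)]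
    · refine Finset.prod_congr rfl fun s hs => ?_
      by_cases hA : A (s + 1) ω = a
      · have h1 := numPulls_mono A a ω (Nat.succ_le_of_lt (Finset.mem_range.1 hs))
        have h2 := numPulls_succ A a s ω
        rw [if_pos hA] at h2
        simp only [Nat.succ_eq_add_one] at h1
        rw [if_pos hA, if_pos ⟨hA, by omega⟩]
      · rw [if_neg hA, if_neg fun h => hA h.1]
    · intro s _ hs
      have h1 := numPulls_mono A a ω (not_lt.1 fun h => hs (Finset.mem_range.2 h))
      exact if_neg fun h => absurd h.2 (not_lt.2 h1)
  have h2 : ∀ r, (∏ s ∈ Finset.range r, if A (s + 1) ω = a then g (Y (s + 1) ω) else 1)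
      = ∏ s ∈ pullRounds A a r ω, g (Y s ω) := by
    intro r
    induction r with
    | zero => simp [pullRounds]
    | succ r ih =>
      rw [Finset.prod_range_succ, ih, pullRounds_succ]
      split_ifs
      · rw [Finset.prod_insert (notMem_pullRounds_succ A a r ω), mul_comm]
      · rw [mul_one]
  rw [h1, h2, ← Finset.prod_fiberwise_of_maps_to (g := fun s => Y s ω) (t := S)]
  · rw [← Finset.prod_coe_sort]
    refine Finset.prod_congr rfl fun x _ => ?_
    rw [pullType, ← Finset.prod_const]
    exact Finset.prod_congr rfl fun s hs => by rw [(Finset.mem_filter.1 hs).2]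
  · intro s hs
    obtain ⟨h1, h2⟩ := Finset.mem_filter.1 hs
    obtain ⟨r, rfl⟩ : ∃ r, s = r + 1 := ⟨s - 1, by have := (Finset.mem_Icc.1 h1).1; omega⟩
    exact hω r h2

/-- The likelihood ratio of the empirical distribution with type `k` with respect to the weights
`w`, extended by `0` outside `S`. -/
def typeRatio {S : Finset ℝ} (w : S → ℝ) (k : S → ℕ) (y : ℝ) : ℝ :=
  ∑ x : S, if y = x then typeWeights k x / w x else 0

lemma typeRatio_coe {S : Finset ℝ} (w : S → ℝ) (k : S → ℕ) (x : S) :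
    typeRatio w k x = typeWeights k x / w x := by
  simp [typeRatio]

lemma typeRatio_nonneg {S : Finset ℝ} {w : S → ℝ} (hw : ∀ x, 0 < w x) (k : S → ℕ) (y : ℝ) :
    0 ≤ typeRatio w k y := by
  refine Finset.sum_nonneg fun x _ => ?_
  split_ifs
  · exact div_nonneg (by unfold typeWeights; positivity) (hw x).le
  · exact le_rfl

lemma measurable_typeRatio {S : Finset ℝ} (w : S → ℝ) (k : S → ℕ) :
    Measurable (typeRatio w k) := by
  unfold typeRatio
  refine Finset.measurable_fun_sum _ fun x _ => ?_
  exact Measurable.ite (measurableSet_singleton _) measurable_const measurable_const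

lemma typeRatio_le {S : Finset ℝ} {w : S → ℝ} (hw : ∀ x, 0 < w x) (k : S → ℕ) (y : ℝ) :
    typeRatio w k y ≤ ∑ x, typeWeights k x / w x := by
  refine Finset.sum_le_sum fun x _ => ?_
  split_ifs
  · exact le_rfl
  · exact div_nonneg (by unfold typeWeights; positivity) (hw x).le

lemma sum_mul_typeRatio {S : Finset ℝ} {w : S → ℝ} (hw : ∀ x, 0 < w x) {k : S → ℕ}
    (hk : ∑ x, k x ≠ 0) : ∑ x, w x * typeRatio w k x = 1 := by
  simp only [typeRatio_coe, mul_div_cancel₀ _ (hw _).ne', typeWeights, ← Finset.sum_div]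
  rw [← Nat.cast_sum, div_self (by exact_mod_cast hk)]

/-- On a sample of type `k`, the likelihood ratio with respect to `w` is the exponential of the
sample size times the relative entropy. -/
lemma prod_typeRatio_pow {S : Finset ℝ} {w : S → ℝ} (hw : ∀ x, 0 < w x) {k : S → ℕ}
    (hk : ∑ x, k x ≠ 0) :
    ∏ x : S, typeRatio w k x ^ k x
      = Real.exp ((∑ x, k x : ℕ) * relEntropy (typeWeights k) w) := by
  rw [relEntropy, Finset.mul_sum, Real.exp_sum]
  refine Finset.prod_congr rfl fun x _ => ?_
  have hn : ((∑ x, k x : ℕ) : ℝ) ≠ 0 := by exact_mod_cast hk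
  rw [typeRatio_coe, ← mul_assoc, typeWeights, mul_div_cancel₀ _ hn]
  rcases Nat.eq_zero_or_pos (k x) with h0 | h0
  · simp [h0]
  · have hpos : (0 : ℝ) < k x / (∑ x, k x : ℕ) / w x := by
      have : (0 : ℝ) < k x := by exact_mod_cast h0
      have : (0 : ℝ) < (∑ x, k x : ℕ) := by exact_mod_cast Nat.pos_of_ne_zero hk
      have := hw x
      positivity
    rw [← Real.rpow_natCast, Real.rpow_def_of_pos hpos, mul_comm]

end Types

/-! ### The martingale structure of a run -/

section Run

variable {𝒜 : Type*} [DecidableEq 𝒜] {Ω : Type*} [MeasurableSpace Ω]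
  {ν : 𝒜 → Measure ℝ} {P : Measure Ω}
  {ℱ : Filtration ℕ (inferInstance : MeasurableSpace Ω)} {A : ℕ → Ω → 𝒜} {Y : ℕ → Ω → ℝ}

lemma norm_indicator_one_le {α : Type*} (D : Set α) (x : α) :
    ‖D.indicator (fun _ => (1 : ℝ)) x‖ ≤ 1 := by
  by_cases h : x ∈ D <;> simp [h]

lemma IsBanditRun.measurable_numPulls (run : IsBanditRun ν P ℱ A Y) (a : 𝒜) (t : ℕ) :
    Measurable[ℱ t] (numPulls A a t) := by
  induction t with
  | zero =>
    have : numPulls A a 0 = fun _ => 0 := by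
      funext ω
      simp [numPulls, pullRounds]
    rw [this]
    exact measurable_const
  | succ t ih =>
    have : numPulls A a (t + 1)
        = fun ω => numPulls A a t ω + if A (t + 1) ω = a then 1 else 0 :=
      funext fun ω => numPulls_succ A a t ω
    rw [this]
    exact (ih.mono (ℱ.mono t.le_succ) le_rfl).add
      (Measurable.ite (ℱ.mono t.le_succ _ (run.measurable_arm t a)) measurable_const
        measurable_const)

variable [IsProbabilityMeasure P]

lemma IsBanditRun.integral_mul_indicator (run : IsBanditRun ν P ℱ A Y) {t : ℕ} {a : 𝒜}
    {W : Ω → ℝ} (hW : StronglyMeasurable[ℱ t] W) {C : ℝ} (hC : ∀ ω, ‖W ω‖ ≤ C)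
    (hWa : ∀ ω, A (t + 1) ω ≠ a → W ω = 0) {B : Set ℝ} (hB : MeasurableSet B) :
    Integrable (fun ω => W ω * (Y (t + 1) ⁻¹' B).indicator (fun _ => (1 : ℝ)) ω) P ∧
    ∫ ω, W ω * (Y (t + 1) ⁻¹' B).indicator (fun _ => (1 : ℝ)) ω ∂P
      = (ν a).real B * ∫ ω, W ω ∂P := by
  have hYB : MeasurableSet (Y (t + 1) ⁻¹' B) := ℱ.le (t + 1) _ (run.measurable_payoff t hB)
  have hind : Integrable ((Y (t + 1) ⁻¹' B).indicator fun _ => (1 : ℝ)) P :=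
    (integrable_const 1).indicator hYB
  have hint : Integrable (fun ω => W ω * (Y (t + 1) ⁻¹' B).indicator (fun _ => (1 : ℝ)) ω) P :=
    hind.bdd_mul (hW.mono (ℱ.le t)).aestronglyMeasurable (ae_of_all _ hC)
  refine ⟨hint, ?_⟩
  have h1 := condExp_mul_of_stronglyMeasurable_left hW hint hind
  rw [← integral_condExp (ℱ.le t), ← integral_const_mul]
  refine integral_congr_ae ?_
  filter_upwards [h1, run.condLaw_payoff t B hB] with ω h2 h3
  refine h2.trans ?_
  rw [Pi.mul_apply, h3]
  by_cases hA : A (t + 1) ω = a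
  · rw [hA, mul_comm]
  · simp [hWa ω hA]

lemma IsBanditRun.ae_payoff_mem (run : IsBanditRun ν P ℱ A Y) {a : 𝒜} {S : Finset ℝ}
    (hS : ν a (S : Set ℝ)ᶜ = 0) :
    ∀ᵐ ω ∂P, ∀ t, A (t + 1) ω = a → Y (t + 1) ω ∈ S := by
  rw [ae_all_iff]
  intro t
  obtain ⟨hi, hint⟩ := run.integral_mul_indicator
    (stronglyMeasurable_const.indicator (run.measurable_arm t a)) (norm_indicator_one_le _)
    (a := a) (fun ω h => by simp [h]) S.measurableSet.compl
  rw [measureReal_def, hS, ENNReal.toReal_zero, zero_mul, integral_eq_zero_iff_of_nonneg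
    (fun ω => mul_nonneg (Set.indicator_nonneg (by simp) _) (Set.indicator_nonneg (by simp) _))
    hi] at hint
  filter_upwards [hint] with ω hω hA
  by_contra hY
  simp [hA, hY] at hω

lemma IsBanditRun.integral_mul_payoff (run : IsBanditRun ν P ℱ A Y) {t : ℕ} {a : 𝒜}
    {S : Finset ℝ} (hS : ν a (S : Set ℝ)ᶜ = 0)
    {W : Ω → ℝ} (hW : StronglyMeasurable[ℱ t] W) {C : ℝ} (hC : ∀ ω, ‖W ω‖ ≤ C)
    (hWa : ∀ ω, A (t + 1) ω ≠ a → W ω = 0) (g : ℝ → ℝ) :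
    Integrable (fun ω => W ω * g (Y (t + 1) ω)) P ∧
    ∫ ω, W ω * g (Y (t + 1) ω) ∂P = (∑ x, weights S (ν a) x * g x) * ∫ ω, W ω ∂P := by
  have hae : (fun ω => W ω * g (Y (t + 1) ω)) =ᵐ[P] fun ω => ∑ x : S,
      g x * (W ω * (Y (t + 1) ⁻¹' {(x : ℝ)}).indicator (fun _ => (1 : ℝ)) ω) := by
    filter_upwards [run.ae_payoff_mem hS] with ω hω
    by_cases hA : A (t + 1) ω = a
    · rw [Finset.sum_eq_single ⟨_, hω t hA⟩]
      · simp [mul_comm]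
      · intro x _ hx
        have : Y (t + 1) ω ≠ x := fun h => hx (Subtype.ext h.symm)
        simp [this]
      · simp
    · simp [hWa ω hA]
  have hstep := fun x : S =>
    run.integral_mul_indicator hW hC hWa (measurableSet_singleton (x : ℝ))
  refine ⟨(integrable_congr hae).2
    (integrable_finsetSum _ fun x _ => (hstep x).1.const_mul _), ?_⟩
  rw [integral_congr_ae hae, integral_finsetSum _ fun x _ => (hstep x).1.const_mul _,
    Finset.sum_mul]
  refine Finset.sum_congr rfl fun x _ => ?_
  rw [integral_const_mul, (hstep x).2, weights]
  ring

/-- The likelihood ratio product is a martingale of mean one. -/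
lemma IsBanditRun.pullProd_integral (run : IsBanditRun ν P ℱ A Y) {a : 𝒜}
    {S : Finset ℝ} (hS : ν a (S : Set ℝ)ᶜ = 0) {g : ℝ → ℝ} (hg : Measurable g)
    (hg0 : ∀ y, 0 ≤ g y) {C : ℝ} (hC : ∀ y, g y ≤ C)
    (hg1 : ∑ x, weights S (ν a) x * g x = 1) (n t : ℕ) :
    StronglyMeasurable[ℱ t] (pullProd g A Y a n t) ∧
    (∃ C', ∀ ω, ‖pullProd g A Y a n t ω‖ ≤ C') ∧ ∫ ω, pullProd g A Y a n t ω ∂P = 1 := by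
  induction t with
  | zero =>
    have : pullProd g A Y a n 0 = fun _ => 1 := by
      funext ω
      simp [pullProd]
    rw [this]
    exact ⟨stronglyMeasurable_const, ⟨1, by simp⟩, by simp⟩
  | succ t ih =>
    obtain ⟨hmeas, ⟨C', hC'⟩, hint⟩ := ih
    set D : Set Ω := {ω | A (t + 1) ω = a ∧ numPulls A a t ω < n} with hD
    have hDm : MeasurableSet[ℱ t] D :=
      MeasurableSet.inter (run.measurable_arm t a)
        (run.measurable_numPulls a t (measurableSet_Iio (a := n)))
    have hsucc : ∀ ω, pullProd g A Y a n (t + 1) ω = pullProd g A Y a n t ω *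
        if ω ∈ D then g (Y (t + 1) ω) else 1 := fun ω => Finset.prod_range_succ _ _
    have hC0 : 0 ≤ C := (hg0 0).trans (hC 0)
    refine ⟨?_, ⟨C' * (C + 1), fun ω => ?_⟩, ?_⟩
    · rw [show pullProd g A Y a n (t + 1) = _ from funext hsucc]
      refine (hmeas.mono (ℱ.mono t.le_succ)).mul ?_
      exact (Measurable.ite (ℱ.mono t.le_succ _ hDm) (hg.comp (run.measurable_payoff t))
        measurable_const).stronglyMeasurable
    · rw [hsucc, norm_mul]
      refine mul_le_mul (hC' ω) ?_ (norm_nonneg _) ((norm_nonneg _).trans (hC' ω))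
      split_ifs
      · rw [Real.norm_of_nonneg (hg0 _)]
        linarith [hC (Y (t + 1) ω)]
      · simpa using hC0
    · have hM : Integrable (pullProd g A Y a n t) P :=
        Integrable.of_bound (hmeas.mono (ℱ.le t)).aestronglyMeasurable C' (ae_of_all _ hC')
      have hDm' : MeasurableSet D := ℱ.le t _ hDm
      obtain ⟨hi, heq⟩ := run.integral_mul_payoff hS (hmeas.indicator hDm)
        (C := C') (fun ω => (norm_indicator_le_norm_self _ _).trans (hC' ω))
        (fun ω h => Set.indicator_of_notMem (fun hω => h hω.1) _) g
      have hsplit : ∀ ω, pullProd g A Y a n (t + 1) ω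
          = D.indicator (pullProd g A Y a n t) ω * g (Y (t + 1) ω)
            + Dᶜ.indicator (pullProd g A Y a n t) ω := by
        intro ω
        rw [hsucc]
        by_cases hω : ω ∈ D <;> simp [hω]
      rw [integral_congr_ae (ae_of_all _ hsplit), integral_add hi (hM.indicator hDm'.compl), heq,
        hg1, one_mul, integral_indicator hDm', integral_indicator hDm'.compl,
        integral_add_compl hDm' hM, hint]

/-- A form of the maximal inequality that bounds the probability that the type `k` of the payoffs
of the arm `a` ever occurs by `exp (-n K)`, where `n` is the size and `K` the relative entropy of
the type: the random variable `M k` has mean at most one and is at least `exp (n K)` on this event. -/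
lemma IsBanditRun.exists_type_majorant (run : IsBanditRun ν P ℱ A Y) {a : 𝒜}
    {S : Finset ℝ} (hS : ν a (S : Set ℝ)ᶜ = 0) (hpos : ∀ x, 0 < weights S (ν a) x) (T : ℕ) :
    ∃ M : (S → ℕ) → Ω → ℝ, (∀ k ω, 0 ≤ M k ω) ∧
      (∀ k, Integrable (M k) P) ∧ (∀ k, ∫ ω, M k ω ∂P ≤ 1) ∧
      ∀ᵐ ω ∂P, ∀ t ≤ T, numPulls A a t ω ≠ 0 →
        Real.exp (numPulls A a t ω *
          relEntropy (typeWeights (pullType S A Y a t ω)) (weights S (ν a)))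
          ≤ M (pullType S A Y a t ω) ω := by
  set w := weights S (ν a)
  -- the type of size `0` has no weights and plays no role
  refine ⟨fun k => if ∑ x, k x = 0 then 0 else pullProd (typeRatio w k) A Y a (∑ x, k x) T,
    fun k ω => ?_, fun k => ?_, fun k => ?_, ?_⟩
  · dsimp only
    split_ifs
    · exact le_rfl
    · refine Finset.prod_nonneg fun s _ => ?_
      split_ifs
      · exact typeRatio_nonneg hpos _ _
      · exact zero_le_one
  · dsimp only
    split_ifs with h
    · exact integrable_zero _ _ _
    · obtain ⟨h1, ⟨C, hC⟩, -⟩ := run.pullProd_integral hS (measurable_typeRatio w k)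
        (typeRatio_nonneg hpos k) (typeRatio_le hpos k) (sum_mul_typeRatio hpos h) (∑ x, k x) T
      exact Integrable.of_bound (h1.mono (ℱ.le T)).aestronglyMeasurable C (ae_of_all _ hC)
  · dsimp only
    split_ifs with h
    · simp
    · exact (run.pullProd_integral hS (measurable_typeRatio w k)
        (typeRatio_nonneg hpos k) (typeRatio_le hpos k) (sum_mul_typeRatio hpos h)
        (∑ x, k x) T).2.2.le
  · filter_upwards [run.ae_payoff_mem hS] with ω hω t htT hn
    have hk := sum_pullType hω t
    rw [if_neg (by rwa [hk]), hk, pullProd_eq_prod_pow _ hω htT,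
      prod_typeRatio_pow hpos (by rwa [hk]), hk]

end Run

/-! ### Counting rounds by types -/

section Counting

/-- Types of size `n` weighted by `exp (-δ n)` have a finite total weight, by factorization. -/
lemma sum_exp_neg_types_le (S : Finset ℝ) {δ : ℝ} (hδ : 0 < δ) (N : ℕ) :
    ∑ k ∈ Fintype.piFinset fun _ : S => Finset.range N, Real.exp (-δ * (∑ x, k x : ℕ))
      ≤ (1 - Real.exp (-δ))⁻¹ ^ S.card := by
  have hr1 : Real.exp (-δ) < 1 := by simpa using hδ
  have hprod : ∀ k : S → ℕ, Real.exp (-δ * (∑ x, k x : ℕ)) = ∏ x, Real.exp (-δ) ^ k x := by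
    intro k
    rw [Finset.prod_pow_eq_pow_sum, ← Real.exp_nat_mul, mul_comm]
  simp only [hprod]
  rw [Finset.sum_prod_piFinset, Finset.prod_const, Finset.card_univ, Fintype.card_coe]
  refine pow_le_pow_left₀ (Finset.sum_nonneg fun i _ => by positivity) ?_ _
  rw [← tsum_geometric_of_lt_one (Real.exp_pos _).le hr1]
  exact (summable_geometric_of_lt_one (Real.exp_pos _).le hr1).sum_le_tsum _
    fun i _ => by positivity

/-- If every fibre of `κ` over a type of size `n` has at most `exp (-δ n) M` elements, where `M` is
a random variable of mean at most one attached to the type, then the expected number of elements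
is bounded independently of the range of the types. -/
lemma exists_integrable_card_le {Ω : Type*} [MeasurableSpace Ω] {P : Measure Ω} {S : Finset ℝ}
    {M : (S → ℕ) → Ω → ℝ} (hM0 : ∀ k ω, 0 ≤ M k ω) (hMi : ∀ k, Integrable (M k) P)
    (hM1 : ∀ k, ∫ ω, M k ω ∂P ≤ 1) {δ : ℝ} (hδ : 0 < δ) (N : ℕ) :
    ∃ F : Ω → ℝ, Integrable F P ∧ ∫ ω, F ω ∂P ≤ (1 - Real.exp (-δ))⁻¹ ^ S.card ∧
      ∀ ω, ∀ (I : Finset ℕ) (κ : ℕ → S → ℕ), (∀ t ∈ I, ∀ x, κ t x < N) →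
        (∀ t ∈ I, ((I.filter fun r => κ r = κ t).card : ℝ)
          ≤ Real.exp (-δ * (∑ x, κ t x : ℕ)) * M (κ t) ω) →
        (I.card : ℝ) ≤ F ω := by
  classical
  refine ⟨fun ω => ∑ k ∈ Fintype.piFinset fun _ : S => Finset.range N,
    Real.exp (-δ * (∑ x, k x : ℕ)) * M k ω,
    integrable_finsetSum _ fun k _ => (hMi k).const_mul _, ?_, ?_⟩
  · rw [integral_finsetSum _ fun k _ => (hMi k).const_mul _]
    refine le_trans (Finset.sum_le_sum fun k _ => ?_) (sum_exp_neg_types_le S hδ N)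
    rw [integral_const_mul]
    exact mul_le_of_le_one_right (Real.exp_pos _).le (hM1 k)
  · intro ω I κ hN hfib
    rw [Finset.card_eq_sum_card_fiberwise (f := κ)
      (t := Fintype.piFinset fun _ : S => Finset.range N)]
    · rw [Nat.cast_sum]
      refine Finset.sum_le_sum fun k _ => ?_
      rcases (I.filter fun r => κ r = k).eq_empty_or_nonempty with h | ⟨t, ht⟩
      · rw [h]
        simpa using mul_nonneg (Real.exp_pos _).le (hM0 k ω)
      · obtain ⟨h1, rfl⟩ := Finset.mem_filter.1 ht
        exact hfib t h1
    · intro t ht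
      simpa using hN t ht

lemma card_filter_lt_le {I : Finset ℕ} (hI : ∀ t ∈ I, 1 ≤ t) {x : ℝ}
    (hx : ∀ t ∈ I, (t : ℝ) < x) (hx0 : 0 ≤ x) : (I.card : ℝ) ≤ x := by
  have hsub : I ⊆ Finset.Icc 1 ⌊x⌋₊ := fun t ht =>
    Finset.mem_Icc.2 ⟨hI t ht, Nat.le_floor (hx t ht).le⟩
  have h1 : I.card ≤ ⌊x⌋₊ := by simpa using Finset.card_le_card hsub
  exact (by exact_mod_cast h1 : (I.card : ℝ) ≤ ⌊x⌋₊).trans (Nat.floor_le hx0)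

end Counting

/-! ### The indices of the strategy -/

section Index

variable {𝒜 : Type*} [DecidableEq 𝒜] {Ω : Type*} {A : ℕ → Ω → 𝒜} {Y : ℕ → Ω → ℝ}

lemma lt_of_index_lt {f : ℕ → ℝ} {a : 𝒜} {t : ℕ} {ω : Ω} {q : ℝ} (hq : q ∈ Set.Icc (0 : ℝ) 1)
    (h : index f A Y a t ω < q) :
    (f t : EReal) <
      (((numPulls A a t ω : ℝ≥0∞) * Kinf (empDist A Y a t ω) q : ℝ≥0∞) : EReal) := by
  by_contra! hle
  have hle' : q ≤ index f A Y a t ω := le_csSup ⟨1, fun r hr => hr.1.2⟩ ⟨hq, hle⟩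
  exact absurd hle' (not_le.2 h)

lemma le_of_lt_index {f : ℕ → ℝ} {a : 𝒜} {t : ℕ} {ω : Ω} {q : ℝ} (hq : 0 ≤ q)
    (h : q < index f A Y a t ω) :
    (((numPulls A a t ω : ℝ≥0∞) * Kinf (empDist A Y a t ω) q : ℝ≥0∞) : EReal)
      ≤ (f t : EReal) := by
  -- the supremum of the empty set is `0`, which is not larger than `q`
  obtain ⟨r, hr, hqr⟩ := exists_lt_of_lt_csSup (Set.nonempty_iff_ne_empty.2 fun hempty => by
    rw [index, hempty, Real.sSup_empty] at h
    exact absurd h (not_lt.2 hq)) h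
  refine le_trans ?_ hr.2
  rw [EReal.coe_ennreal_le_coe_ennreal_iff]
  gcongr
  exact Kinf_mono _ hqr.le

lemma numPulls_le_one_add {a : 𝒜} {n : ℕ} {ω : Ω} (h1 : numPulls A a n ω = 1) (T : ℕ) :
    numPulls A a T ω ≤ 1 + ((Finset.Ico n T).filter fun t => A (t + 1) ω = a).card := by
  rcases le_total T n with h | h
  · exact (numPulls_mono A a ω h).trans (by simp [h1])
  · induction T, h using Nat.le_induction with
    | base => simp [h1]
    | succ t ht ih =>
      rw [numPulls_succ, ← Finset.insert_Ico_right_eq_Ico_add_one ht, Finset.filter_insert]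
      split_ifs
      · rw [Finset.card_insert_of_notMem (by simp)]
        omega
      · simpa using ih

end Index

/-! ### Rounds with a low and with a high index -/

section Bounds

variable {𝒜 : Type*} [DecidableEq 𝒜] {Ω : Type*} [MeasurableSpace Ω]
  {ν : 𝒜 → Measure ℝ} {P : Measure Ω} [IsProbabilityMeasure P]
  {ℱ : Filtration ℕ (inferInstance : MeasurableSpace Ω)} {A : ℕ → Ω → 𝒜} {Y : ℕ → Ω → ℝ}

/-- The expected number of rounds in which the index of the arm `b` lies below the level `q` is
bounded, as soon as low empirical means have `Kinf` strictly below the relative entropy. While the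
type of the arm stays at a type of size `n`, the index is low only in rounds
`t < exp (n Kinf)`, and the type occurs with probability at most `exp (-n K)`. -/
lemma IsBanditRun.exists_card_index_lt_le (run : IsBanditRun ν P ℱ A Y) {b : 𝒜}
    {S : Finset ℝ} (hSI : (S : Set ℝ) ⊆ Set.Icc 0 1) (hS : ν b (S : Set ℝ)ᶜ = 0)
    (hpos : ∀ x, 0 < weights S (ν b) x) {q s δ : ℝ} (hq : q ∈ Set.Icc (0 : ℝ) 1) (hδ : 0 < δ)
    (hK : ∀ p : Measure ℝ, IsProbabilityMeasure p → p (S : Set ℝ)ᶜ = 0 → mean p ≤ q →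
      Kinf p q ≤ ENNReal.ofReal ((1 - s) * relEntropy (weights S p) (weights S (ν b))) ∧
      δ ≤ s * relEntropy (weights S p) (weights S (ν b)))
    {n : ℕ} (hn : 1 ≤ n) (hpull : ∀ᵐ ω ∂P, numPulls A b n ω = 1) (T : ℕ) :
    ∃ F : Ω → ℝ, Integrable F P ∧ ∫ ω, F ω ∂P ≤ (1 - Real.exp (-δ))⁻¹ ^ S.card ∧
      ∀ᵐ ω ∂P, (((Finset.Ico n T).filter fun t =>
        index (fun t => Real.log t) A Y b t ω < q).card : ℝ) ≤ F ω := by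
  obtain ⟨M, hM0, hMi, hM1, hM⟩ := run.exists_type_majorant hS hpos T
  obtain ⟨F, hF, hF1, hFc⟩ := exists_integrable_card_le hM0 hMi hM1 hδ (T + 1)
  refine ⟨F, hF, hF1, ?_⟩
  filter_upwards [run.ae_payoff_mem hS, hM, hpull] with ω hω hMω hpω
  have hpulls : ∀ t, n ≤ t → numPulls A b t ω ≠ 0 := fun t ht => by
    have := numPulls_mono A b ω ht
    simp only at this
    omega
  refine hFc ω _ (fun t => pullType S A Y b t ω) (fun t ht x => ?_) (fun t ht => ?_)
  · have h1 : pullType S A Y b t ω x ≤ numPulls A b t ω := Finset.card_filter_le _ _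
    have h2 := numPulls_le A b t ω
    have h3 := (Finset.mem_Ico.1 (Finset.mem_filter.1 ht).1).2
    omega
  · obtain ⟨htI, -⟩ := Finset.mem_filter.1 ht
    have htT := (Finset.mem_Ico.1 htI).2
    have hnt := hpulls t (Finset.mem_Ico.1 htI).1
    set k := pullType S A Y b t ω with hk
    have hkn : ∑ x, k x = numPulls A b t ω := sum_pullType hω t
    set E := relEntropy (typeWeights k) (weights S (ν b)) with hE
    -- every round with the type `k` and a low index comes before `exp (n (1 - s) K)`
    have hround : ∀ r ∈ ((Finset.Ico n T).filter fun t =>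
        index (fun t => Real.log t) A Y b t ω < q).filter fun r => pullType S A Y b r ω = k,
        1 ≤ r ∧ (r : ℝ) < Real.exp ((∑ x, k x : ℕ) * ((1 - s) * E)) ∧ δ ≤ s * E := by
      intro r hr
      obtain ⟨hr1, hrk⟩ := Finset.mem_filter.1 hr
      obtain ⟨hrI, hidx⟩ := Finset.mem_filter.1 hr1
      have hnr := (Finset.mem_Ico.1 hrI).1
      have hr0 : 1 ≤ r := hn.trans hnr
      have hr0' : (1 : ℝ) ≤ r := by exact_mod_cast hr0
      obtain ⟨hpP, hpS, hpw⟩ := empDist_eq_of_type hω (hpulls r hnr)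
      have hlt := lt_of_index_lt hq hidx
      have hlog : 0 ≤ Real.log r := Real.log_nonneg hr0'
      have hmean : mean (empDist A Y b r ω) ≤ q := by
        by_contra! hgt
        rw [Kinf_eq_zero_of_lt_mean ⟨hpP, S, hSI, hpS⟩ hgt, mul_zero] at hlt
        simp only [EReal.coe_ennreal_zero] at hlt
        exact absurd hlt (not_lt.2 (by exact_mod_cast hlog))
      obtain ⟨hKle, hδle⟩ := hK _ hpP hpS hmean
      rw [hpw, hrk, ← hE] at hKle hδle
      have hnum : numPulls A b r ω = ∑ x, k x := by rw [← sum_pullType hω r, hrk]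
      rw [hnum] at hlt
      have hlt2 : (Real.log r : EReal)
          < ((ENNReal.ofReal ((∑ x, k x : ℕ) * ((1 - s) * E)) : ℝ≥0∞) : EReal) := by
        refine hlt.trans_le ?_
        rw [EReal.coe_ennreal_le_coe_ennreal_iff, ENNReal.ofReal_mul (by positivity),
          ENNReal.ofReal_natCast]
        gcongr
      rw [EReal.coe_ennreal_ofReal, EReal.coe_lt_coe_iff, lt_max_iff] at hlt2
      refine ⟨hr0, ?_, hδle⟩
      rw [← Real.log_lt_iff_lt_exp (by linarith)]
      exact hlt2.resolve_right (not_lt.2 hlog)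
    have hδE := (hround t (Finset.mem_filter.2 ⟨ht, rfl⟩)).2.2
    have hMk := hMω t htT.le hnt
    rw [← hk, ← hE, ← hkn] at hMk
    calc ((Finset.card _ : ℕ) : ℝ)
        ≤ Real.exp ((∑ x, k x : ℕ) * ((1 - s) * E)) :=
          card_filter_lt_le (fun r hr => (hround r hr).1) (fun r hr => (hround r hr).2.1)
            (Real.exp_pos _).le
      _ ≤ Real.exp (-δ * (∑ x, k x : ℕ)) * Real.exp ((∑ x, k x : ℕ) * E) := by
          rw [← Real.exp_add, Real.exp_le_exp]
          nlinarith [(Nat.cast_nonneg (∑ x, k x) : (0 : ℝ) ≤ (∑ x, k x : ℕ))]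
      _ ≤ _ := mul_le_mul_of_nonneg_left hMk (Real.exp_pos _).le

/-- The expected number of pulls of the arm `a` in rounds in which its index exceeds `q` is at most
`log T / C` plus a constant, if `Kinf p q < C` forces `p` away from the distribution of the arm.
After `log T / C` pulls, a large index requires such an atypical empirical distribution. -/
lemma IsBanditRun.exists_card_lt_index_le (run : IsBanditRun ν P ℱ A Y) {a : 𝒜}
    {S : Finset ℝ} (hS : ν a (S : Set ℝ)ᶜ = 0)
    (hpos : ∀ x, 0 < weights S (ν a) x) {q C δ : ℝ} (hq : 0 ≤ q) (hC : 0 < C) (hδ : 0 < δ)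
    (hK : ∀ p : Measure ℝ, IsProbabilityMeasure p → p (S : Set ℝ)ᶜ = 0 →
      Kinf p q < ENNReal.ofReal C → δ ≤ relEntropy (weights S p) (weights S (ν a)))
    {n : ℕ} (hn : 1 ≤ n) (hpull : ∀ᵐ ω ∂P, numPulls A a n ω = 1) {T : ℕ} (hT : 1 ≤ T) :
    ∃ F : Ω → ℝ, Integrable F P ∧ ∫ ω, F ω ∂P ≤ (1 - Real.exp (-δ))⁻¹ ^ S.card ∧
      ∀ᵐ ω ∂P, (((Finset.Ico n T).filter fun t =>
        A (t + 1) ω = a ∧ q < index (fun t => Real.log t) A Y a t ω).card : ℝ)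
          ≤ Real.log T / C + 1 + F ω := by
  obtain ⟨M, hM0, hMi, hM1, hM⟩ := run.exists_type_majorant hS hpos T
  obtain ⟨F, hF, hF1, hFc⟩ := exists_integrable_card_le hM0 hMi hM1 hδ (T + 1)
  refine ⟨F, hF, hF1, ?_⟩
  filter_upwards [run.ae_payoff_mem hS, hM, hpull] with ω hω hMω hpω
  have hlogT : 0 ≤ Real.log T := Real.log_nonneg (by exact_mod_cast hT)
  set I := (Finset.Ico n T).filter fun t =>
        A (t + 1) ω = a ∧ q < index (fun t => Real.log t) A Y a t ω with hI
  rw [← Finset.card_filter_add_card_filter_not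
    (fun t => numPulls A a t ω < ⌊Real.log T / C⌋₊ + 1), Nat.cast_add]
  have hinj : Set.InjOn (fun t => numPulls A a t ω) (I : Set ℕ) :=
    (numPulls_injOn A a ω).mono fun t ht => (Finset.mem_filter.1 ht).2.1
  refine add_le_add ?_ ?_
  · have h1 : (I.filter fun t => numPulls A a t ω < ⌊Real.log T / C⌋₊ + 1).card
        ≤ (Finset.range (⌊Real.log T / C⌋₊ + 1)).card :=
      Finset.card_le_card_of_injOn (fun t => numPulls A a t ω)
        (fun t ht => by simpa using (Finset.mem_filter.1 ht).2)
        (hinj.mono fun t ht => (Finset.mem_filter.1 ht).1)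
    rw [Finset.card_range] at h1
    calc _ ≤ ((⌊Real.log T / C⌋₊ + 1 : ℕ) : ℝ) := by exact_mod_cast h1
      _ ≤ Real.log T / C + 1 := by
        push_cast
        linarith [Nat.floor_le (div_nonneg hlogT hC.le)]
  · refine hFc ω _ (fun t => pullType S A Y a t ω) (fun t ht x => ?_) (fun t ht => ?_)
    · have h1 : pullType S A Y a t ω x ≤ numPulls A a t ω := Finset.card_filter_le _ _
      have h2 := numPulls_le A a t ω
      have h3 := (Finset.mem_Ico.1 (Finset.mem_filter.1 (Finset.mem_filter.1 ht).1).1).2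
      omega
    · obtain ⟨htI, hlarge⟩ := Finset.mem_filter.1 ht
      obtain ⟨htn, -, hidx⟩ := Finset.mem_filter.1 htI
      obtain ⟨hnt, htT⟩ := Finset.mem_Ico.1 htn
      have hpulls : numPulls A a t ω ≠ 0 := by omega
      obtain ⟨hpP, hpS, hpw⟩ := empDist_eq_of_type hω hpulls
      have hkn := sum_pullType hω t
      -- the empirical distribution is atypical
      have hlow : Kinf (empDist A Y a t ω) q < ENNReal.ofReal C := by
        by_contra! hge
        have h1 := le_of_lt_index hq hidx
        have h2 : ((ENNReal.ofReal (numPulls A a t ω * C) : ℝ≥0∞) : EReal)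
            ≤ (Real.log t : EReal) := by
          refine le_trans ?_ h1
          rw [EReal.coe_ennreal_le_coe_ennreal_iff, ENNReal.ofReal_mul (by positivity),
            ENNReal.ofReal_natCast]
          gcongr
        rw [EReal.coe_ennreal_ofReal, EReal.coe_le_coe_iff] at h2
        have h3 : Real.log T / C < numPulls A a t ω :=
          (Nat.lt_floor_add_one _).trans_le (by exact_mod_cast not_lt.1 hlarge)
        rw [div_lt_iff₀ hC] at h3
        have h4 : Real.log t ≤ Real.log T :=
          Real.log_le_log (by exact_mod_cast hn.trans hnt) (by exact_mod_cast htT.le)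
        linarith [le_max_left ((numPulls A a t ω : ℝ) * C) 0]
      have hδE := hK _ hpP hpS hlow
      have hMk := hMω t htT.le hpulls
      rw [hpw] at hδE
      set k := pullType S A Y a t ω with hk
      have hone : ((I.filter fun t => ¬ numPulls A a t ω < ⌊Real.log T / C⌋₊ + 1).filter
          fun r => pullType S A Y a r ω = k).card ≤ 1 := by
        rw [Finset.card_le_one]
        intro r hr r' hr'
        obtain ⟨h1, h2⟩ := Finset.mem_filter.1 hr
        obtain ⟨h1', h2'⟩ := Finset.mem_filter.1 hr'
        refine hinj (Finset.mem_filter.1 h1).1 (Finset.mem_filter.1 h1').1 ?_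
        simp only
        rw [← sum_pullType hω r, ← sum_pullType hω r', h2, h2']
      rw [← hkn] at hMk
      calc ((Finset.card _ : ℕ) : ℝ) ≤ 1 := by exact_mod_cast hone
        _ ≤ Real.exp (-δ * (∑ x, k x : ℕ)) * Real.exp ((∑ x, k x : ℕ) *
              relEntropy (typeWeights k) (weights S (ν a))) := by
            rw [← Real.exp_add, Real.one_le_exp_iff]
            nlinarith [(Nat.cast_nonneg (∑ x, k x) : (0 : ℝ) ≤ (∑ x, k x : ℕ))]
        _ ≤ _ := mul_le_mul_of_nonneg_left hMk (Real.exp_pos _).le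

end Bounds

/-! ### Expected numbers of pulls and regret -/

lemma gap_nonneg {𝒜 : Type*} [Fintype 𝒜] (ν : 𝒜 → Measure ℝ) (a : 𝒜) : 0 ≤ gap ν a :=
  sub_nonneg.2 (le_ciSup (f := fun a => mean (ν a)) (Set.finite_range _).bddAbove a)

section Regret

variable {𝒜 : Type*} [Fintype 𝒜] [DecidableEq 𝒜]

/-- The finite-time bound on the expected number of pulls of a suboptimal arm, with a remainder
that depends only on the distributions of the arms. -/
theorem exists_integral_numPulls_le [Nonempty 𝒜] {ν : 𝒜 → Measure ℝ}
    (hν : ∀ a, ν a ∈ finSuppDist) (hμ : bestMean ν ∈ Set.Ioo (0 : ℝ) 1) {a : 𝒜}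
    (ha : 0 < gap ν a) {c : ℝ} (hc : 0 < c) :
    ∃ H : ℝ, ∀ (Ω : Type*) [MeasurableSpace Ω] (P : Measure Ω) [IsProbabilityMeasure P]
      (ℱ : Filtration ℕ (inferInstance : MeasurableSpace Ω))
      (A : ℕ → Ω → 𝒜) (Y : ℕ → Ω → ℝ),
      IsBanditRun ν P ℱ A Y → IsKinfStrategy (fun t => Real.log t) P A Y →
      ∀ T : ℕ, 1 ≤ T → ∫ ω, (numPulls A a T ω : ℝ) ∂P
        ≤ (1 + c) * Real.log T / (Kinf (ν a) (bestMean ν)).toReal + H := by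
  obtain ⟨b, hb⟩ := exists_eq_ciSup_of_finite (f := fun a => mean (ν a))
  replace hb : mean (ν b) = bestMean ν := hb
  set μ := bestMean ν
  set K := (Kinf (ν a) μ).toReal
  have hK0 : 0 < K := ENNReal.toReal_pos (Kinf_pos (hν a) (sub_pos.1 ha)).ne'
    (Kinf_lt_top (hν a) hμ.1.le hμ.2).ne
  have hC0 : 0 < K / (1 + c) := by positivity
  have hCK : K / (1 + c) < K := div_lt_self hK0 (by linarith)
  obtain ⟨Sa, -, hSa, hposa⟩ := exists_support_of_mem_finSuppDist (hν a)
  obtain ⟨Sb, hSbI, hSb, hposb⟩ := exists_support_of_mem_finSuppDist (hν b)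
  obtain ⟨ε₁, hε₁, δ₁, hδ₁, hfar⟩ :=
    exists_relEntropy_ge_of_Kinf_lt (hν a) hSa hposa hμ.1.le hμ.2 hC0.le hCK
  -- the level `μ - ε` that separates low and high indices
  obtain ⟨ε, hε, hεε₁, hεμ⟩ : ∃ ε > 0, ε < ε₁ ∧ ε < μ :=
    ⟨min ε₁ μ / 2, by have := lt_min hε₁ hμ.1; positivity,
      by linarith [min_le_left ε₁ μ], by linarith [min_le_right ε₁ μ, hμ.1]⟩
  obtain ⟨s, -, δ₂, hδ₂, hbest⟩ :=
    exists_Kinf_le_mul_relEntropy (hν b) hSbI hposb hε (hεμ.trans hμ.2)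
  rw [hb] at hbest
  -- the supremum that defines an index need not be attained, so that an index of at least `μ - ε`
  -- is used at a level `q` strictly below `μ - ε`
  obtain ⟨q, hq0, hqε₁, hqε⟩ : ∃ q, 0 ≤ q ∧ μ - ε₁ ≤ q ∧ q < μ - ε :=
    ⟨max 0 (μ - ε₁), le_max_left _ _, le_max_right _ _, max_lt (by linarith) (by linarith)⟩
  refine ⟨2 + (1 - Real.exp (-δ₂))⁻¹ ^ Sb.card + (1 - Real.exp (-δ₁))⁻¹ ^ Sa.card, ?_⟩
  intro Ω _ P _ ℱ A Y run strat T hT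
  have hcard : 1 ≤ Fintype.card 𝒜 := Fintype.card_pos
  obtain ⟨F₁, hF₁, hF₁1, hF₁c⟩ := run.exists_card_index_lt_le hSbI hSb hposb
    (q := μ - ε) ⟨by linarith, by linarith [hμ.2]⟩ hδ₂ hbest hcard
    (strat.mono fun ω h => h.1 b) T
  obtain ⟨F₂, hF₂, hF₂1, hF₂c⟩ := run.exists_card_lt_index_le hSa hposa hq0 hC0 hδ₁
    (fun p hp hpS hlt => hfar p hp hpS ((Kinf_mono p hqε₁).trans_lt hlt)) hcard
    (strat.mono fun ω h => h.1 a) hT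
  have hle : ∀ᵐ ω ∂P, (numPulls A a T ω : ℝ)
      ≤ (Real.log T / (K / (1 + c)) + 2) + (F₁ ω + F₂ ω) := by
    filter_upwards [strat, hF₁c, hF₂c] with ω hω h1 h2
    have h3 := numPulls_le_one_add (hω.1 a) T
    have h4 : ((Finset.Ico (Fintype.card 𝒜) T).filter fun t => A (t + 1) ω = a).card
        ≤ ((Finset.Ico (Fintype.card 𝒜) T).filter fun t =>
            index (fun t => Real.log t) A Y b t ω < μ - ε).card
          + ((Finset.Ico (Fintype.card 𝒜) T).filter fun t =>
            A (t + 1) ω = a ∧ q < index (fun t => Real.log t) A Y a t ω).card := by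
      refine le_trans (Finset.card_le_card fun t ht => ?_) (Finset.card_union_le _ _)
      obtain ⟨htI, htA⟩ := Finset.mem_filter.1 ht
      rw [Finset.mem_union, Finset.mem_filter, Finset.mem_filter]
      rcases lt_or_ge (index (fun t => Real.log t) A Y b t ω) (μ - ε) with h | h
      · exact Or.inl ⟨htI, h⟩
      · have hmax := (hω.2 t (Finset.mem_Ico.1 htI).1 b).1
        rw [htA] at hmax
        exact Or.inr ⟨htI, htA, hqε.trans_le (h.trans hmax)⟩
    have h5 := h3.trans (Nat.add_le_add_left h4 1)
    rw [← Nat.cast_le (α := ℝ), Nat.cast_add, Nat.cast_add, Nat.cast_one] at h5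
    linarith
  calc ∫ ω, (numPulls A a T ω : ℝ) ∂P
      ≤ ∫ ω, ((Real.log T / (K / (1 + c)) + 2) + (F₁ ω + F₂ ω)) ∂P :=
        integral_mono_of_nonneg (ae_of_all _ fun ω => Nat.cast_nonneg _)
          ((integrable_const _).add (hF₁.add hF₂)) hle
    _ = Real.log T / (K / (1 + c)) + 2 + (∫ ω, F₁ ω ∂P + ∫ ω, F₂ ω ∂P) := by
        rw [integral_add (integrable_const _) (hF₁.fun_add hF₂), integral_add hF₁ hF₂]
        simp
    _ ≤ _ := by
        rw [div_div_eq_mul_div, mul_comm (Real.log T)]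
        linarith

/-- The regret is the sum of the expected numbers of pulls, weighted by the gaps. -/
lemma IsBanditRun.regret_eq {ν : 𝒜 → Measure ℝ} (hν : ∀ a, ν a ∈ finSuppDist)
    {Ω : Type*} [MeasurableSpace Ω] {P : Measure Ω} [IsProbabilityMeasure P]
    {ℱ : Filtration ℕ (inferInstance : MeasurableSpace Ω)} {A : ℕ → Ω → 𝒜} {Y : ℕ → Ω → ℝ}
    (run : IsBanditRun ν P ℱ A Y) (T : ℕ) :
    regret ν P Y T = ∑ a, gap ν a * ∫ ω, (numPulls A a T ω : ℝ) ∂P := by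
  set D : ℕ → 𝒜 → Ω → ℝ := fun t a => {ω | A (t + 1) ω = a}.indicator fun _ => (1 : ℝ) with hD
  have hDi : ∀ t a, Integrable (D t a) P := fun t a =>
    (integrable_const _).indicator (ℱ.le t _ (run.measurable_arm t a))
  have hpay : ∀ t a, Integrable (fun ω => D t a ω * Y (t + 1) ω) P ∧
      ∫ ω, D t a ω * Y (t + 1) ω ∂P = mean (ν a) * ∫ ω, D t a ω ∂P := by
    intro t a
    obtain ⟨hP, S, -, hS⟩ := hν a
    rw [mean_eq_sum_weights hS]
    exact run.integral_mul_payoff hS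
      (stronglyMeasurable_const.indicator (run.measurable_arm t a)) (norm_indicator_one_le _)
      (fun ω h => by simp [h]) fun y => y
  have hpoint : ∀ ω, T * bestMean ν - ∑ t ∈ Finset.Icc 1 T, Y t ω
      = ∑ t ∈ Finset.range T, ∑ a, (bestMean ν * D t a ω - D t a ω * Y (t + 1) ω) := by
    intro ω
    induction T with
    | zero => simp
    | succ T ih =>
      have hone : ∑ a, D T a ω = 1 := by
        simp [hD, Set.indicator_apply]
      rw [Finset.sum_range_succ, ← ih, Finset.sum_Icc_succ_top (by omega),
        Finset.sum_sub_distrib, ← Finset.mul_sum, ← Finset.sum_mul, hone]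
      push_cast
      ring
  have hnum : ∀ a, ∫ ω, (numPulls A a T ω : ℝ) ∂P
      = ∑ t ∈ Finset.range T, ∫ ω, D t a ω ∂P := by
    intro a
    rw [← integral_finsetSum _ fun t _ => hDi t a]
    exact integral_congr_ae (ae_of_all _ fun ω => numPulls_eq_sum_indicator A a T ω)
  have hterm : ∀ t a, Integrable (fun ω => bestMean ν * D t a ω - D t a ω * Y (t + 1) ω) P :=
    fun t a => ((hDi t a).const_mul _).sub (hpay t a).1
  rw [regret, integral_congr_ae (ae_of_all _ hpoint),
    integral_finsetSum _ fun t _ => integrable_finsetSum _ fun a _ => hterm t a]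
  simp only [hnum, Finset.mul_sum]
  rw [Finset.sum_comm]
  refine Finset.sum_congr rfl fun t _ => ?_
  rw [integral_finsetSum _ fun a _ => hterm t a]
  refine Finset.sum_congr rfl fun a _ => ?_
  rw [integral_sub ((hDi t a).const_mul _) (hpay t a).1, integral_const_mul, (hpay t a).2, gap]
  ring

end Regret

lemma limsup_div_log_le {u : ℕ → ℝ} {L : ℝ}
    (h : ∀ c : ℝ, 0 < c → ∃ H : ℝ, ∀ T : ℕ, 1 ≤ T → u T ≤ (1 + c) * L * Real.log T + H) :
    limsup (fun T : ℕ => ((u T / Real.log T : ℝ) : EReal)) atTop ≤ (L : EReal) := by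
  refine EReal.le_of_forall_lt_iff_le.1 fun z hz => ?_
  rw [EReal.coe_lt_coe_iff] at hz
  obtain ⟨c, hc, hcz⟩ : ∃ c > 0, (1 + c) * L < z := by
    have hden : 0 < |L| + 1 := by positivity
    refine ⟨(z - L) / (|L| + 1), div_pos (sub_pos.2 hz) hden, ?_⟩
    have h1 : (z - L) / (|L| + 1) * L ≤ (z - L) / (|L| + 1) * |L| :=
      mul_le_mul_of_nonneg_left (le_abs_self L) (div_pos (sub_pos.2 hz) hden).le
    have h2 : (z - L) / (|L| + 1) * (|L| + 1) = z - L := div_mul_cancel₀ _ hden.ne'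
    have h3 := div_pos (sub_pos.2 hz) hden
    nlinarith
  obtain ⟨H, hH⟩ := h c hc
  have hlog : Tendsto (fun T : ℕ => Real.log T) atTop atTop :=
    Real.tendsto_log_atTop.comp tendsto_natCast_atTop_atTop
  have hev : ∀ᶠ T : ℕ in atTop, H / Real.log T < z - (1 + c) * L :=
    (hlog.const_div_atTop H).eventually_lt_const (sub_pos.2 hcz)
  refine limsup_le_of_le (by isBoundedDefault) ?_
  filter_upwards [hev, hlog.eventually_gt_atTop 0, eventually_ge_atTop 1] with T h1 h2 h3
  rw [EReal.coe_le_coe_iff]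
  have h4 : u T / Real.log T ≤ (1 + c) * L + H / Real.log T := by
    rw [div_le_iff₀ h2, add_mul, div_mul_cancel₀ _ h2.ne']
    exact hH T h3
  linarith

end KinfBandit

end

theorem mainTheorem3 {𝒜 : Type*} [Fintype 𝒜] [DecidableEq 𝒜] [Nonempty 𝒜]
    (ν : 𝒜 → Measure ℝ) (hν : ∀ a, ν a ∈ KinfBandit.finSuppDist)
    (hμ : KinfBandit.bestMean ν ∈ Set.Ioo (0 : ℝ) 1) :
    (∀ a, 0 < KinfBandit.gap ν a →
      0 < KinfBandit.Kinf (ν a) (KinfBandit.bestMean ν) ∧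
      KinfBandit.Kinf (ν a) (KinfBandit.bestMean ν) < ∞) ∧
    ∃ h : ℝ → ℝ, ∀ (Ω : Type*) [MeasurableSpace Ω] (P : Measure Ω) [IsProbabilityMeasure P]
      (ℱ : Filtration ℕ (inferInstance : MeasurableSpace Ω))
      (A : ℕ → Ω → 𝒜) (Y : ℕ → Ω → ℝ),
      KinfBandit.IsBanditRun ν P ℱ A Y →
      KinfBandit.IsKinfStrategy (fun t => Real.log t) P A Y →
      (∀ c : ℝ, 0 < c → ∀ T : ℕ, 1 ≤ T →
        KinfBandit.regret ν P Y T ≤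
          (∑ a with 0 < KinfBandit.gap ν a, KinfBandit.gap ν a *
            ((1 + c) * Real.log T /
              (KinfBandit.Kinf (ν a) (KinfBandit.bestMean ν)).toReal)) + h c) ∧
      limsup (fun T : ℕ => ((KinfBandit.regret ν P Y T / Real.log T : ℝ) : EReal)) atTop ≤
        ((∑ a with 0 < KinfBandit.gap ν a, KinfBandit.gap ν a /
          (KinfBandit.Kinf (ν a) (KinfBandit.bestMean ν)).toReal : ℝ) : EReal) ∧
      ∀ a, 0 < KinfBandit.gap ν a →
        limsup (fun T : ℕ =>
          (((∫ ω, (KinfBandit.numPulls A a T ω : ℝ) ∂P) / Real.log T : ℝ) : EReal)) atTop ≤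
          ((1 / (KinfBandit.Kinf (ν a) (KinfBandit.bestMean ν)).toReal : ℝ) : EReal) := by
  have hKpos : ∀ a, 0 < KinfBandit.gap ν a →
      0 < KinfBandit.Kinf (ν a) (KinfBandit.bestMean ν) ∧
      KinfBandit.Kinf (ν a) (KinfBandit.bestMean ν) < ∞ := fun a ha =>
    ⟨KinfBandit.Kinf_pos (hν a) (sub_pos.1 ha), KinfBandit.Kinf_lt_top (hν a) hμ.1.le hμ.2⟩
  refine ⟨hKpos, ?_⟩
  -- the remainders are chosen before the probability space and the run
  have hH := fun (a : 𝒜) (ha : 0 < KinfBandit.gap ν a) (c : ℝ) (hc : 0 < c) =>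
    KinfBandit.exists_integral_numPulls_le hν hμ ha hc
  choose! H hH using hH
  refine ⟨fun c => ∑ a with 0 < KinfBandit.gap ν a, KinfBandit.gap ν a * H a c, ?_⟩
  intro Ω _ P _ ℱ A Y run strat
  have hreg : ∀ c : ℝ, 0 < c → ∀ T : ℕ, 1 ≤ T →
      KinfBandit.regret ν P Y T ≤
        (∑ a with 0 < KinfBandit.gap ν a, KinfBandit.gap ν a *
          ((1 + c) * Real.log T /
            (KinfBandit.Kinf (ν a) (KinfBandit.bestMean ν)).toReal))
        + ∑ a with 0 < KinfBandit.gap ν a, KinfBandit.gap ν a * H a c := by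
    intro c hc T hT
    rw [run.regret_eq hν, ← Finset.sum_add_distrib, Finset.sum_filter]
    refine Finset.sum_le_sum fun a _ => ?_
    split_ifs with ha
    · rw [← mul_add]
      exact mul_le_mul_of_nonneg_left (hH a ha c hc Ω P ℱ A Y run strat T hT) ha.le
    · rw [le_antisymm (not_lt.1 ha) (KinfBandit.gap_nonneg ν a), zero_mul]
  refine ⟨hreg, KinfBandit.limsup_div_log_le fun c hc =>
    ⟨∑ a with 0 < KinfBandit.gap ν a, KinfBandit.gap ν a * H a c, fun T hT => ?_⟩, fun a ha =>
    KinfBandit.limsup_div_log_le fun c hc => ⟨H a c, fun T hT => ?_⟩⟩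
  · refine (hreg c hc T hT).trans_eq ?_
    congr 1
    rw [Finset.mul_sum, Finset.sum_mul]
    refine Finset.sum_congr rfl fun a _ => ?_
    ring
  · refine (hH a ha c hc Ω P ℱ A Y run strat T hT).trans_eq ?_
    ring
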